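/- Let $M$ be a discounted Markov decision process with finite state space $\mathcal S$, finite action space $\mathcal A$, transition probabilities $\mathcal P(s'|s,a)$, rewards $R(s,a)\in[0,1]$, discount factor $\gamma\in[0,1)$ and initial distribution $p$. Let $\mathcal X=\Delta(\mathcal A)^{\mathcal S}$ be the set of stationary randomized policies. For a distribution $\nu$ on $\mathcal S$ let $V_\nu(\pi)=-\mathbb E[\sum_{h\ge0}\gamma^hR(s_h,a_h)]$ with $s_0\sim\nu$, $a_h\sim\pi_{s_h}$, $s_{h+1}\sim\mathcal P(\cdot|s_h,a_h)$; $V_\nu$ is extended to a neighbourhood of $\mathcal X$ by the same power series in $\gamma$, so that $\nabla V_\nu$ is defined on $\mathcal X$. Put $V_\nu^*=\min_{\mathcal X}V_\nu$, $d_\nu(\pi)(s)=(1-\gamma)\sum_{h}\gamma^h\Pr(s_h=s)$ and $L_F=2\gamma|\mathcal A|/(1-\gamma)^3$. Norms and inner products are Frobenius. Let $\mu$ be a distribution on $\mathcal S$, $\pi_0\in\mathcal X$, and $\sigma_F\ge0$. Given an oracle that, for every $\pi\in\mathcal X$, returns $\widehat\nabla V_\mu(\pi)$ with mean $\nabla V_\mu(\pi)$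 and $\mathbb E\|\widehat\nabla V_\mu(\pi)-\nabla V_\mu(\pi)\|^2\le\sigma_F^2$, projected stochastic policy gradient (P-SPG) with deterministic step sizes $\eta_t$ and independent oracle samples is $$\pi_{t+1}=\operatorname{proj}_{\mathcal X}\bigl(\pi_t-\eta_t\widehat\nabla V_\mu(\pi_t)\bigr).$$ For $\rho\ge0$ let $\mathcal D_\rho(\pi)=-2\rho\min_{\pi'\in\mathcal X}\bigl[\langle\nabla V_\mu(\pi),\pi'-\pi\rangle+\tfrac\rho2\|\pi'-\pi\|^2\bigr]$, and let $\pi_t^+$ be a minimizer over $\pi'\in\mathcal X$ of $\langle\nabla V_\mu(\pi_t),\pi'\rangle+\tfrac{L_F}2\|\pi'-\pi_t\|^2$ (unique if $\gamma>0$). There is an absolute constant $C>0$ such that for every $M$, $\mu$, $\pi_0$, $\sigma_F$ as above and every $\varepsilon>0$: (i) There are positive non-increasing step sizes with $2L_F\eta_t\le1$, not depending on the oracle, such that for every integer $T\ge1$ with $$T\ \ge\ C\,\bigl(V_\mu(\pi_0)-V_\mu^*\bigr)\left(\frac{|\mathcal A|}{(1-\gamma)^3\varepsilon^2}+\frac{\sigma_F^2|\mathcal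 A|}{(1-\gamma)^3\varepsilon^4}\right)$$ P-SPG satisfies $\min_{0\le t\le T-1}\mathbb E[\mathcal D_{3L_F}(\pi_t)]\le\varepsilon^2$. (ii) Let $\pi^\star\in\mathcal X$ be a policy that minimizes both $V_p$ and $V_\mu$ over $\mathcal X$, and let $\kappa<\infty$ satisfy $d_p(\pi^\star)\le\kappa\mu$ and $d_\mu(\pi^\star)\le\kappa\mu$ pointwise (that is, $\kappa$ bounds the distribution mismatch coefficients $\|d_p(\pi^\star)/\mu\|_\infty$ and $\|d_\mu(\pi^\star)/\mu\|_\infty$). Put $$B=\frac{\kappa^2|\mathcal A||\mathcal S|}{(1-\gamma)^5\varepsilon}+\frac{\sigma_F^2\kappa^4|\mathcal A|^2|\mathcal S|^2}{(1-\gamma)^7\varepsilon^3}.$$ There are positive non-increasing step sizes with $2L_F\eta_t\le1$, not depending on the oracle, such that for every integer $T\ge C\,B\,(1+\log(1+B))$ P-SPG satisfies $\min_{0\le t\le T}\mathbb E[V_p(\pi_t^+)-V_p^*]\le\varepsilon$. -/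

import Mathlib

open MeasureTheory ProbabilityTheory

noncomputable section

/-- A finite discounted Markov decision process with transition model `trans`, mean reward
function `reward` with values in `[0, 1]`, discount factor `γ ∈ [0, 1)` and initial state
distribution `p`. -/
structure MDP (S A : Type*) [Fintype S] [Fintype A] where
  trans : S → A → S → ℝ
  trans_mem : ∀ s a, trans s a ∈ stdSimplex ℝ S
  reward : S → A → ℝ
  reward_mem : ∀ s a, reward s a ∈ Set.Icc (0 : ℝ) 1
  γ : ℝ
  γ_nonneg : 0 ≤ γ
  γ_lt_one : γ < 1
  p : S → ℝ
  p_mem : p ∈ stdSimplex ℝ S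

/-- Matrices indexed by state-action pairs, with the Frobenius norm and inner product. -/
abbrev PolicySpace (S A : Type*) : Type _ := EuclideanSpace ℝ (S × A)

/-- The set `Δ(A)^S` of stationary randomized policies. -/
def policies (S A : Type*) [Fintype S] [Fintype A] : Set (PolicySpace S A) :=
  {π | ∀ s, (fun a => π (s, a)) ∈ stdSimplex ℝ A}

section MDPDefs

variable {S A : Type*} [Fintype S] [Fintype A]

/-- The law of the state `s_h` when `s_0 ∼ ν`, `a_h ∼ π(s_h, ·)`, `s_{h+1} ∼ trans s_h a_h`.
The formula is polynomial in `π` and is used on the whole matrix space, so that the value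
function has a gradient. -/
def stateDist (M : MDP S A) (ν : S → ℝ) (π : PolicySpace S A) : ℕ → S → ℝ
  | 0 => ν
  | h + 1 => fun s' => ∑ s, ∑ a, stateDist M ν π h s * π (s, a) * M.trans s a s'

/-- The expected reward at step `h`. -/
def expReward (M : MDP S A) (ν : S → ℝ) (π : PolicySpace S A) (h : ℕ) : ℝ :=
  ∑ s, ∑ a, stateDist M ν π h s * π (s, a) * M.reward s a

/-- `V_ν(π)`: minus the expected discounted total reward from the initial distribution `ν`. -/
def value (M : MDP S A) (ν : S → ℝ) (π : PolicySpace S A) : ℝ :=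
  -∑' h : ℕ, M.γ ^ h * expReward M ν π h

/-- `V_ν^*`, the minimum of `V_ν` over all policies. -/
def valueStar (M : MDP S A) (ν : S → ℝ) : ℝ :=
  sInf (value M ν '' policies S A)

/-- The discounted state visitation distribution `d_ν(π)`. -/
def visitation (M : MDP S A) (ν : S → ℝ) (π : PolicySpace S A) (s : S) : ℝ :=
  (1 - M.γ) * ∑' h : ℕ, M.γ ^ h * stateDist M ν π h s

/-- `L_F = 2 γ |A| / (1 - γ)^3`. -/
def LF (M : MDP S A) : ℝ :=
  2 * M.γ * Fintype.card A / (1 - M.γ) ^ 3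

end MDPDefs

section Bregman

variable {E : Type*} [NormedAddCommGroup E] [InnerProductSpace ℝ E] [CompleteSpace E]

/-- The Bregman divergence `D_ω(x, y)`. -/
def bregman (ω : E → ℝ) (x y : E) : ℝ :=
  ω x - ω y - inner ℝ (gradient ω y) (x - y)

/-- The Euclidean distance generating function. -/
def euclDGF (x : E) : ℝ := ‖x‖ ^ 2 / 2

/-- The Bregman forward-backward envelope
`𝒟_ρ(x) = -2ρ min_{y ∈ X} (⟨∇F(x), y - x⟩ + ρ D_ω(y, x))` of `F` over `X`, for the Euclidean
distance generating function. -/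
def bfbe (X : Set E) (F : E → ℝ) (ρ : ℝ) (x : E) : ℝ :=
  -2 * ρ * sInf ((fun y => inner ℝ (gradient F x) (y - x) + ρ * bregman euclDGF y x) '' X)

/-- `z` is a point `x⁺`, that is, a minimizer over `X` of `y ↦ ⟨∇F(x), y⟩ + ρ D_ω(y, x)`, for the
Euclidean distance generating function. -/
def IsMirrorStep (X : Set E) (F : E → ℝ) (ρ : ℝ) (x z : E) : Prop :=
  z ∈ X ∧ IsMinOn (fun y => inner ℝ (gradient F x) y + ρ * bregman euclDGF y x) X z

/-- `z` is the Euclidean projection of `x` onto `X`. -/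
def IsProj (X : Set E) (x z : E) : Prop :=
  z ∈ X ∧ ∀ y ∈ X, ‖x - z‖ ≤ ‖x - y‖

end Bregman

section Algorithm

variable {S A : Type*} [Fintype S] [Fintype A]

/-- `g π ζ`, `ζ ∼ law`, is an unbiased estimate of `∇V_μ(π)` with variance at most `σ²` in the
Frobenius norm, for every policy `π`. -/
structure IsGradientOracle (M : MDP S A) (μ : S → ℝ) (σ : ℝ) {Ξ : Type*} [MeasurableSpace Ξ]
    (law : Measure Ξ) (g : PolicySpace S A → Ξ → PolicySpace S A) : Prop where
  measurable : Measurable (Function.uncurry g)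
  integrable : ∀ π ∈ policies S A, Integrable (g π) law
  unbiased : ∀ π ∈ policies S A, ∫ ζ, g π ζ ∂law = gradient (value M μ) π
  integrable_sq : ∀ π ∈ policies S A,
    Integrable (fun ζ => ‖g π ζ - gradient (value M μ) π‖ ^ 2) law
  variance_le : ∀ π ∈ policies S A,
    ∫ ζ, ‖g π ζ - gradient (value M μ) π‖ ^ 2 ∂law ≤ σ ^ 2

/-- `π 0, π 1, …` are the iterates of projected stochastic policy gradient from `π₀` with step
sizes `η`, driven by the independent samples `ξ 0, ξ 1, …` of distribution `law`. -/
structure IsPSPG (η : ℕ → ℝ) (π₀ : PolicySpace S A) {Ξ : Type*} [MeasurableSpace Ξ]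
    (law : Measure Ξ) (g : PolicySpace S A → Ξ → PolicySpace S A)
    {Ω : Type*} [MeasurableSpace Ω] (P : Measure Ω) (ξ : ℕ → Ω → Ξ)
    (π : ℕ → Ω → PolicySpace S A) : Prop where
  measurable : ∀ t, Measurable (ξ t)
  map_eq : ∀ t, P.map (ξ t) = law
  indep : iIndepFun ξ P
  init : ∀ ω, π 0 ω = π₀
  step : ∀ t ω, IsProj (policies S A) (π t ω - η t • g (π t ω) (ξ t ω)) (π (t + 1) ω)

/-- Positive, non-increasing step sizes with `η t ≤ 1 / (2 L_F)`. -/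
def IsStepSize (M : MDP S A) (η : ℕ → ℝ) : Prop :=
  (∀ t, 0 < η t) ∧ Antitone η ∧ ∀ t, 2 * LF M * η t ≤ 1

/-- `|A| / ((1-γ)³ ε²) + σ² |A| / ((1-γ)³ ε⁴)`. -/
def stationarityRate (M : MDP S A) (σ ε : ℝ) : ℝ :=
  Fintype.card A / ((1 - M.γ) ^ 3 * ε ^ 2)
    + σ ^ 2 * Fintype.card A / ((1 - M.γ) ^ 3 * ε ^ 4)

/-- `κ² |A| |S| / ((1-γ)⁵ ε) + σ² κ⁴ |A|² |S|² / ((1-γ)⁷ ε³)`. -/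
def globalRate (M : MDP S A) (κ σ ε : ℝ) : ℝ :=
  κ ^ 2 * (Fintype.card A * Fintype.card S) / ((1 - M.γ) ^ 5 * ε)
    + σ ^ 2 * κ ^ 4 * ((Fintype.card A : ℝ) ^ 2 * (Fintype.card S : ℝ) ^ 2)
      / ((1 - M.γ) ^ 7 * ε ^ 3)

end Algorithm

end

/-! Both parts follow the Moreau envelope `envelope` of `V_μ` over the policies (the infimum of
`V_μ(y) + L ‖y - x‖²`, with `L = L_F`), not the function value, so constant step sizes tolerate
noise of any variance. The proximal point `z` of `x` is fixed by projected gradient steps on `V_μ +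
L ‖· - x‖²`, and comparing a noisy projected step from `x` with `z` makes the envelope decrease in
expectation, up to an error of order `L η² σ²`.

The MDP enters twice. The flow equation of the occupancy weights and the performance difference
identity show that `V_μ` is differentiable on the policies with `L_F`-Lipschitz gradient
(`isSmoothOver_value`). Gradient domination under distribution mismatch bounds the gap at `x⁺`, for
both `V_p` and `V_μ`, by a multiple of `r(x) = L ‖x - x⁺‖` (`value_sub_le_of_isMirrorStep`).

For (i), the Lyapunov function `envelope + 2 L η V_μ` loses a multiple of `η 𝒟_{3L}` per step
(`envelope_add_step_le`); telescoping concludes. For (ii), let `a_t` be the mean envelope gap and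
`e_t = E r(π_t)²`. Then `a_{t+1} ≤ a_t - (η/9) e_t + L η² σ²` (`envelope_step_le`), and `a_t² ≤ K²
e_t` by gradient domination and Jensen. If `e_t` stayed above `ε²/K²`, the noise would cost at most
half of the decrease, so `a_t` would be `O(1/t)` after half the time, too small to pay for the
decreases of the other half (`exists_le_of_quadratic_recursion`). Some `e_t` is thus small, and the
gap of `V_p` at `π_t⁺` is at most `K r(π_t)`. -/

set_option linter.unusedSectionVars false

/-! ### Smooth functions on a compact convex set: proximal points, envelopes and one-step descent -/

section SmoothOptimization

variable {E : Type*} [NormedAddCommGroup E] [InnerProductSpace ℝ E] [CompleteSpace E]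

theorem hasGradientAt_add {f g : E → ℝ} {f' g' x : E} (hf : HasGradientAt f f' x)
    (hg : HasGradientAt g g' x) : HasGradientAt (fun y => f y + g y) (f' + g') x := by
  rw [hasGradientAt_iff_hasFDerivAt] at *
  rw [map_add]
  exact hf.add hg

theorem hasGradientAt_const_mul_norm_sub_sq (c : ℝ) (x z : E) :
    HasGradientAt (fun y => c * ‖y - x‖ ^ 2) ((2 * c) • (z - x)) z := by
  rw [hasGradientAt_iff_hasFDerivAt]
  have h1 : HasFDerivAt (fun y : E => y - x) (ContinuousLinearMap.id ℝ E) z :=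
    (hasFDerivAt_id z).sub_const x
  have h := (h1.norm_sq).const_mul c
  refine h.congr_fderiv ?_
  ext y
  simp
  ring

theorem hasGradientAt_inner (g z : E) : HasGradientAt (fun y => inner ℝ g y) g z := by
  rw [hasGradientAt_iff_hasFDerivAt]
  exact (InnerProductSpace.toDual ℝ E g).hasFDerivAt

theorem gradient_euclDGF (y : E) : gradient euclDGF y = y := by
  have h := hasGradientAt_const_mul_norm_sub_sq (1 / 2) 0 y
  have h2 : (euclDGF : E → ℝ) = fun y => 1 / 2 * ‖y - 0‖ ^ 2 := by
    ext y; simp [euclDGF]; ring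
  rw [h2, h.gradient]
  simp

theorem bregman_euclDGF (x y : E) : bregman euclDGF x y = ‖x - y‖ ^ 2 / 2 := by
  rw [bregman, gradient_euclDGF, norm_sub_sq_real, inner_sub_right, real_inner_self_eq_norm_sq,
    real_inner_comm]
  simp only [euclDGF]
  ring

/-- The first-order optimality condition over a convex set. -/
theorem inner_gradient_nonneg_of_isMinOn {X : Set E} (hX : Convex ℝ X) {f : E → ℝ} {f' z y : E}
    (hf : HasGradientAt f f' z) (hz : z ∈ X) (hmin : IsMinOn f X z) (hy : y ∈ X) :
    0 ≤ inner ℝ f' (y - z) := by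
  rw [hasGradientAt_iff_hasFDerivAt] at hf
  have := hmin.localize.hasFDerivWithinAt_nonneg hf.hasFDerivWithinAt
    (sub_mem_posTangentConeAt_of_segment_subset (hX.segment_subset hz hy))
  simpa using this

theorem IsProj.inner_le_zero {X : Set E} (hX : Convex ℝ X) {x z y : E} (h : IsProj X x z)
    (hy : y ∈ X) : inner ℝ (x - z) (y - z) ≤ 0 := by
  have hmin : IsMinOn (fun y => (1 / 2) * ‖y - x‖ ^ 2) X z := by
    intro y hy
    have := h.2 y hy
    rw [norm_sub_rev x z, norm_sub_rev x y] at this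
    simp only [Set.mem_ofPred_eq]
    gcongr
  have := inner_gradient_nonneg_of_isMinOn hX (hasGradientAt_const_mul_norm_sub_sq _ x z) h.1 hmin hy
  have h2 : x - z = -((2 * (1 / 2) : ℝ) • (z - x)) := by simp
  rw [h2, inner_neg_left]
  linarith

theorem isProj_of_inner_le_zero {X : Set E} {x z : E} (hz : z ∈ X)
    (h : ∀ y ∈ X, inner ℝ (x - z) (y - z) ≤ 0) : IsProj X x z := by
  refine ⟨hz, fun y hy => ?_⟩
  have h1 := h y hy
  have h2 : x - y = (x - z) - (y - z) := by abel
  have h3 : ‖x - y‖ ^ 2 = ‖x - z‖ ^ 2 - 2 * inner ℝ (x - z) (y - z) + ‖y - z‖ ^ 2 := by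
    rw [h2, norm_sub_sq_real]
  refine le_of_sq_le_sq ?_ (norm_nonneg _)
  nlinarith [sq_nonneg ‖y - z‖]

theorem IsProj.norm_sub_le {X : Set E} (hX : Convex ℝ X) {x x' z z' : E} (h : IsProj X x z)
    (h' : IsProj X x' z') : ‖z - z'‖ ≤ ‖x - x'‖ := by
  have h1 := h.inner_le_zero hX h'.1
  have h2 := h'.inner_le_zero hX h.1
  have h3 : ‖z - z'‖ ^ 2 ≤ inner ℝ (x - x') (z - z') := by
    have e : inner ℝ (x - z) (z' - z) + inner ℝ (x' - z') (z - z') =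
        ‖z - z'‖ ^ 2 - inner ℝ (x - x') (z - z') := by
      rw [← real_inner_self_eq_norm_sq, ← neg_sub z z', inner_neg_right, ← sub_eq_neg_add,
        ← inner_sub_left, ← inner_sub_left]
      congr 1
      abel
    linarith
  have h4 := real_inner_le_norm (x - x') (z - z')
  by_contra! hlt
  nlinarith [norm_nonneg (x - x')]

theorem IsProj.unique {X : Set E} (hX : Convex ℝ X) {x z z' : E} (h : IsProj X x z)
    (h' : IsProj X x z') : z = z' := by
  have := h.norm_sub_le hX h'
  rw [sub_self, norm_zero] at this
  exact sub_eq_zero.1 (norm_le_zero_iff.1 this)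

theorem exists_isProj {X : Set E} (hX : IsCompact X) (hne : X.Nonempty) (x : E) :
    ∃ z, IsProj X x z := by
  obtain ⟨z, hz, hmin⟩ := hX.exists_isMinOn hne
    (f := fun y => ‖x - y‖) (by fun_prop)
  exact ⟨z, hz, fun y hy => hmin hy⟩

/-- A mirror step with the Euclidean distance generating function is a projected gradient step. -/
theorem IsMirrorStep.inner_nonneg {X : Set E} (hX : Convex ℝ X) {F : E → ℝ} {ρ : ℝ} {x z y : E}
    (h : IsMirrorStep X F ρ x z) (hy : y ∈ X) :
    0 ≤ inner ℝ (gradient F x + ρ • (z - x)) (y - z) := by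
  have hg := hasGradientAt_add (hasGradientAt_inner (gradient F x) z)
    (hasGradientAt_const_mul_norm_sub_sq (ρ / 2) x z)
  have h2 := h.2
  simp only [bregman_euclDGF] at h2
  have h3 : IsMinOn (fun y => inner ℝ (gradient F x) y + ρ / 2 * ‖y - x‖ ^ 2) X z := by
    convert h2 using 3
    ring
  have := inner_gradient_nonneg_of_isMinOn hX hg h.1 h3 hy
  rwa [mul_div_cancel₀ ρ two_ne_zero] at this

theorem IsMirrorStep.isProj {X : Set E} (hX : Convex ℝ X) {F : E → ℝ} {ρ : ℝ} (hρ : 0 < ρ)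
    {x z : E} (h : IsMirrorStep X F ρ x z) : IsProj X (x - ρ⁻¹ • gradient F x) z := by
  refine isProj_of_inner_le_zero h.1 fun y hy => ?_
  have h1 := h.inner_nonneg hX hy
  have h2 : x - ρ⁻¹ • gradient F x - z = -(ρ⁻¹ • (gradient F x + ρ • (z - x))) := by
    rw [smul_add, smul_smul, inv_mul_cancel₀ hρ.ne', one_smul]
    abel
  rw [h2, inner_neg_left, real_inner_smul_left]
  have := mul_nonneg (inv_pos.2 hρ).le h1
  linarith

/-- `F` has an `L`-Lipschitz gradient on the compact convex set `X`. -/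
structure IsSmoothOver (X : Set E) (F : E → ℝ) (L : ℝ) : Prop where
  convex : Convex ℝ X
  isCompact : IsCompact X
  nonempty : X.Nonempty
  hasGradientAt : ∀ x ∈ X, HasGradientAt F (gradient F x) x
  nonneg : 0 ≤ L
  norm_gradient_sub_le : ∀ x ∈ X, ∀ y ∈ X, ‖gradient F x - gradient F y‖ ≤ L * ‖x - y‖

/-- `z` minimizes `F + L ‖· - x‖²` over `X`. -/
def IsProx (X : Set E) (F : E → ℝ) (L : ℝ) (x z : E) : Prop :=
  z ∈ X ∧ IsMinOn (fun y => F y + L * ‖y - x‖ ^ 2) X z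

/-- The Moreau envelope of `F` over `X` with parameter `1 / (2 L)`. -/
noncomputable def envelope (X : Set E) (F : E → ℝ) (L : ℝ) (x : E) : ℝ :=
  sInf ((fun y => F y + L * ‖y - x‖ ^ 2) '' X)

theorem IsProx.envelope_eq {X : Set E} {F : E → ℝ} {L : ℝ} {x z : E} (h : IsProx X F L x z) :
    envelope X F L x = F z + L * ‖z - x‖ ^ 2 := by
  have : IsLeast ((fun y => F y + L * ‖y - x‖ ^ 2) '' X) (F z + L * ‖z - x‖ ^ 2) :=
    ⟨⟨z, h.1, rfl⟩, by rintro _ ⟨y, hy, rfl⟩; exact h.2 hy⟩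
  exact this.csInf_eq

namespace IsSmoothOver

variable {X : Set E} {F : E → ℝ} {L : ℝ} (h : IsSmoothOver X F L)
include h

theorem continuousOn : ContinuousOn F X := fun x hx =>
  (h.hasGradientAt x hx).continuousAt.continuousWithinAt

theorem continuousOn_gradient : ContinuousOn (gradient F) X := by
  have : LipschitzOnWith L.toNNReal (gradient F) X := by
    refine LipschitzOnWith.of_dist_le_mul fun x hx y hy => ?_
    rw [dist_eq_norm, dist_eq_norm, Real.coe_toNNReal L h.nonneg]
    exact h.norm_gradient_sub_le x hx y hy
  exact this.continuousOn

theorem exists_isProx (x : E) : ∃ z, IsProx X F L x z := by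
  obtain ⟨z, hz, hmin⟩ := h.isCompact.exists_isMinOn h.nonempty
    (f := fun y => F y + L * ‖y - x‖ ^ 2) (h.continuousOn.add (by fun_prop))
  exact ⟨z, hz, hmin⟩

theorem envelope_le (x : E) {y : E} (hy : y ∈ X) :
    envelope X F L x ≤ F y + L * ‖y - x‖ ^ 2 := by
  obtain ⟨z, hz⟩ := h.exists_isProx x
  rw [hz.envelope_eq]
  exact hz.2 hy

/-- First-order optimality of `z`. As a fixed point, `z` can be compared with any projected point by
nonexpansiveness of the projection. -/
theorem isProj_of_isProx {x z : E} (hz : IsProx X F L x z) {α : ℝ} (hα : 0 ≤ α) :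
    IsProj X (z - α • (gradient F z + (2 * L) • (z - x))) z := by
  refine isProj_of_inner_le_zero hz.1 fun y hy => ?_
  have := inner_gradient_nonneg_of_isMinOn h.convex (hasGradientAt_add (h.hasGradientAt z hz.1)
    (hasGradientAt_const_mul_norm_sub_sq L x z)) hz.1 hz.2 hy
  rw [sub_sub_cancel_left, inner_neg_left, real_inner_smul_left]
  have := mul_nonneg hα this
  linarith

/-- The length of the gradient mapping is controlled by that of the proximal step. -/
theorem norm_sub_le_of_isMirrorStep (hL : 0 < L) {x z w : E} (hx : x ∈ X) (hz : IsProx X F L x z)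
    (hw : IsMirrorStep X F L x w) : ‖x - w‖ ≤ 3 * ‖x - z‖ := by
  -- Both `w` and `z` are projections with step `1/L`; the projected points differ by at most `2 ‖x
  -- - z‖`, and the triangle inequality adds one more.
  have h1 := (hw.isProj h.convex hL).norm_sub_le h.convex
    (h.isProj_of_isProx hz (inv_pos.2 hL).le)
  have e : x - L⁻¹ • gradient F x - (z - L⁻¹ • (gradient F z + (2 * L) • (z - x))) =
      -(x - z) - L⁻¹ • (gradient F x - gradient F z) := by
    have : L⁻¹ * (2 * L) = 2 := by field_simp
    rw [smul_add, smul_smul, this]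
    module
  rw [e] at h1
  have h2 : ‖L⁻¹ • (gradient F x - gradient F z)‖ ≤ ‖x - z‖ := by
    rw [norm_smul, Real.norm_of_nonneg (inv_pos.2 hL).le, inv_mul_le_iff₀ hL]
    exact h.norm_gradient_sub_le x hx z hz.1
  have h3 := norm_sub_le (-(x - z)) (L⁻¹ • (gradient F x - gradient F z))
  rw [norm_neg] at h3
  have h4 := norm_sub_le_norm_sub_add_norm_sub x z w
  rw [norm_sub_rev z w] at h4
  linarith

/-- The Lipschitz bound is available only on `X`, so the argument stays on the segment: `F` minus
its quadratic upper model is antitone in the segment parameter. -/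
theorem le_add_inner {x y : E} (hx : x ∈ X) (hy : y ∈ X) :
    F y ≤ F x + inner ℝ (gradient F x) (y - x) + L / 2 * ‖y - x‖ ^ 2 := by
  have hmem : ∀ t ∈ Set.Icc (0 : ℝ) 1, x + t • (y - x) ∈ X := fun t ht =>
    h.convex.add_smul_sub_mem hx hy ht
  have hd : ∀ t ∈ Set.Icc (0 : ℝ) 1, HasDerivAt
      (fun t : ℝ => F (x + t • (y - x)) - t * inner ℝ (gradient F x) (y - x)
        - L / 2 * ‖y - x‖ ^ 2 * t ^ 2)
      (inner ℝ (gradient F (x + t • (y - x))) (y - x) - inner ℝ (gradient F x) (y - x)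
        - L / 2 * ‖y - x‖ ^ 2 * (2 * t)) t := by
    intro t ht
    have h1 := (hasGradientAt_iff_hasFDerivAt.1 (h.hasGradientAt _ (hmem t ht)))
    have h2 : HasDerivAt (fun t : ℝ => x + t • (y - x)) (y - x) t := by
      simpa using ((hasDerivAt_id t).smul_const (y - x)).const_add x
    have h3 := h1.comp_hasDerivAt t h2
    have h4 := (hasDerivAt_id t).mul_const (inner ℝ (gradient F x) (y - x))
    have h5 := (hasDerivAt_pow 2 t).const_mul (L / 2 * ‖y - x‖ ^ 2)
    refine ((h3.sub h4).sub h5).congr_deriv ?_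
    simp
  have hanti := antitoneOn_of_deriv_nonpos (convex_Icc (0 : ℝ) 1)
    (fun t ht => (hd t ht).continuousAt.continuousWithinAt)
    (fun t ht => (hd t (interior_subset ht)).differentiableAt.differentiableWithinAt)
    (fun t ht => by
      have ht := interior_subset ht
      rw [(hd t ht).deriv, ← inner_sub_left]
      have h1 := real_inner_le_norm (gradient F (x + t • (y - x)) - gradient F x) (y - x)
      have h2 := h.norm_gradient_sub_le _ (hmem t ht) x hx
      rw [add_sub_cancel_left, norm_smul, Real.norm_of_nonneg ht.1] at h2
      have h3 := mul_le_mul_of_nonneg_right h2 (norm_nonneg (y - x))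
      nlinarith)
  have := hanti (Set.left_mem_Icc.2 zero_le_one) (Set.right_mem_Icc.2 zero_le_one) zero_le_one
  simp only [one_smul, add_sub_cancel, one_mul, one_pow, mul_one, zero_smul, add_zero, zero_mul,
    sub_zero, ne_eq, OfNat.ofNat_ne_zero, not_false_eq_true, zero_pow, mul_zero] at this
  linarith

theorem neg : IsSmoothOver X (fun x => -F x) L := by
  have hg : ∀ x ∈ X, HasGradientAt (fun x => -F x) (-gradient F x) x := fun x hx => by
    have := h.hasGradientAt x hx
    rw [hasGradientAt_iff_hasFDerivAt] at *
    rw [map_neg]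
    exact this.neg
  refine ⟨h.convex, h.isCompact, h.nonempty, fun x hx => ?_, h.nonneg, fun x hx y hy => ?_⟩
  · rw [(hg x hx).gradient]
    exact hg x hx
  · rw [(hg x hx).gradient, (hg y hy).gradient, ← neg_sub', norm_neg]
    exact h.norm_gradient_sub_le x hx y hy

theorem gradient_neg {x : E} (hx : x ∈ X) : gradient (fun x => -F x) x = -gradient F x := by
  refine HasGradientAt.gradient ?_
  have := h.hasGradientAt x hx
  rw [hasGradientAt_iff_hasFDerivAt] at *
  rw [map_neg]
  exact this.neg

theorem add_inner_le {x y : E} (hx : x ∈ X) (hy : y ∈ X) :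
    F x + inner ℝ (gradient F x) (y - x) - L / 2 * ‖y - x‖ ^ 2 ≤ F y := by
  have h1 := h.neg.le_add_inner hx hy
  rw [h.gradient_neg hx, inner_neg_left] at h1
  linarith

/-- The prox inequality between `z` and `y`, with the upper smoothness bound at `y` and the lower
one at `z`, gives `⟨∇F(x), z - x⟩ + L/2 ‖z - x‖² ≤ ⟨∇F(x), y - x⟩ + 3L/2 ‖y - x‖²`. The `3L/2`,
hence the parameter `3L`, is `L` from the prox plus `L/2` from smoothness. -/
theorem bfbe_le_inner {x z : E} (hx : x ∈ X) (hz : IsProx X F L x z) :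
    bfbe X F (3 * L) x ≤ 6 * L * inner ℝ (gradient F x) (x - z) := by
  obtain ⟨y, hy, hmin⟩ := h.isCompact.exists_isMinOn h.nonempty
    (f := fun y => inner ℝ (gradient F x) (y - x) + 3 * L * bregman euclDGF y x) (by
      simp only [bregman_euclDGF]; fun_prop)
  have hl : IsLeast ((fun y => inner ℝ (gradient F x) (y - x) + 3 * L * bregman euclDGF y x) '' X)
      (inner ℝ (gradient F x) (y - x) + 3 * L * bregman euclDGF y x) :=
    ⟨⟨y, hy, rfl⟩, by rintro _ ⟨y, hy, rfl⟩; exact hmin hy⟩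
  rw [bfbe, hl.csInf_eq, bregman_euclDGF]
  have h1 : F z + L * ‖z - x‖ ^ 2 ≤ F y + L * ‖y - x‖ ^ 2 := hz.2 hy
  have h2 := h.le_add_inner hx hy
  have h3 := h.add_inner_le hx hz.1
  have h4 := mul_nonneg h.nonneg (sq_nonneg ‖z - x‖)
  have h5 : inner ℝ (gradient F x) (x - z) = -inner ℝ (gradient F x) (z - x) := by
    rw [← inner_neg_right, neg_sub]
  rw [h5]
  nlinarith [h.nonneg]

theorem envelope_le_self {x : E} (hx : x ∈ X) : envelope X F L x ≤ F x := by
  simpa using h.envelope_le x hx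

theorem le_envelope {c : ℝ} (hc : ∀ y ∈ X, c ≤ F y) (x : E) : c ≤ envelope X F L x := by
  obtain ⟨z, hz⟩ := h.exists_isProx x
  rw [hz.envelope_eq]
  have := hc z hz.1
  have := mul_nonneg h.nonneg (sq_nonneg ‖z - x‖)
  linarith

/-- An infimum over a compact parameter set is continuous. This yields integrability along the
iterates without a measurable choice of proximal points. -/
theorem continuous_envelope : Continuous (envelope X F L) := by
  have : CompactSpace X := isCompact_iff_compactSpace.1 h.isCompact
  have hF : Continuous fun y : X => F y := continuousOn_iff_continuous_domRestrict.1 h.continuousOn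
  have hc := (isCompact_univ (X := X)).continuous_sInf
    (f := fun (x : E) (y : X) => F y + L * ‖(y : E) - x‖ ^ 2) (by
      change Continuous fun p : E × X => F p.2 + L * ‖(p.2 : E) - p.1‖ ^ 2
      have := hF.comp (continuous_snd (X := E))
      refine Continuous.add this ?_
      fun_prop)
  refine hc.congr fun x => ?_
  rw [envelope]
  congr 1
  ext t
  simp

theorem continuousOn_bfbe (ρ : ℝ) : ContinuousOn (bfbe X F ρ) X := by
  rw [continuousOn_iff_continuous_domRestrict]
  have hF : Continuous fun y : X => gradient F y :=
    continuousOn_iff_continuous_domRestrict.1 h.continuousOn_gradient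
  have hc := h.isCompact.continuous_sInf
    (f := fun (x : X) (y : E) => inner ℝ (gradient F x) (y - x) + ρ * (‖y - x‖ ^ 2 / 2)) (by
      change Continuous fun p : X × E =>
        inner ℝ (gradient F p.1) (p.2 - p.1) + ρ * (‖p.2 - p.1‖ ^ 2 / 2)
      have := hF.comp (continuous_fst (Y := E))
      refine Continuous.add (this.inner (by fun_prop)) ?_
      fun_prop)
  have e : X.domRestrict (bfbe X F ρ) = fun x : X => -2 * ρ * sInf ((fun y : E =>
      inner ℝ (gradient F x) (y - x) + ρ * (‖y - x‖ ^ 2 / 2)) '' X) := by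
    ext x
    simp only [Set.domRestrict_apply, bfbe, bregman_euclDGF]
  rw [e]
  exact hc.const_mul _

/-- Change of the envelope along a projected step in a perturbed gradient direction. -/
theorem envelope_step_le {x z g w : E} {η : ℝ} (hη : 0 ≤ η) (hηL : 2 * L * η ≤ 1) (hx : x ∈ X)
    (hz : IsProx X F L x z) (hw : IsProj X (x - η • g) w) :
    envelope X F L w ≤ envelope X F L x - η * L ^ 2 * ‖x - z‖ ^ 2
      + inner ℝ ((-(2 * L * η)) • ((1 - 2 * L * η) • (x - z) - η • (gradient F x - gradient F z)))
        (g - gradient F x) + L * η ^ 2 * ‖g - gradient F x‖ ^ 2 := by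
  have hL := h.nonneg
  have h1 := h.envelope_le w hz.1
  -- `z` is also a projection with step `η`, so `‖w - z‖` is at most the distance of the projected
  -- points: a noiseless part `a` minus `η` times the noise.
  have h2 := hw.norm_sub_le h.convex (h.isProj_of_isProx hz hη)
  set a := (1 - 2 * L * η) • (x - z) - η • (gradient F x - gradient F z) with ha
  have e : x - η • g - (z - η • (gradient F z + (2 * L) • (z - x))) =
      a - η • (g - gradient F x) := by
    rw [ha]; module
  rw [e] at h2
  -- The factor is `(1 - 2Lη) + ηL`: the quadratic contracts twice as fast as the Lipschitz gradient
  -- expands.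
  have h3 : ‖a‖ ≤ (1 - η * L) * ‖x - z‖ := by
    refine (norm_sub_le _ _).trans ?_
    rw [norm_smul, norm_smul, Real.norm_of_nonneg hη, Real.norm_of_nonneg (by linarith)]
    have := mul_le_mul_of_nonneg_left (h.norm_gradient_sub_le x hx z hz.1) hη
    linarith
  have h4 : ‖a‖ ^ 2 ≤ (1 - η * L) * ‖x - z‖ ^ 2 := by
    have h5 : ‖a‖ ^ 2 ≤ ((1 - η * L) * ‖x - z‖) ^ 2 := by gcongr
    have h6 : 0 ≤ η * L := mul_nonneg hη hL
    have h7 : (1 - η * L) ^ 2 ≤ 1 - η * L := by nlinarith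
    have h8 := mul_le_mul_of_nonneg_right h7 (sq_nonneg ‖x - z‖)
    linarith
  have h9 : ‖w - z‖ ^ 2 ≤ ‖a - η • (g - gradient F x)‖ ^ 2 := by gcongr
  rw [norm_sub_sq_real a, norm_smul, real_inner_smul_right, mul_pow, Real.norm_of_nonneg hη] at h9
  rw [hz.envelope_eq, real_inner_smul_left]
  rw [norm_sub_rev z w] at h1
  rw [norm_sub_rev z x]
  have := mul_le_mul_of_nonneg_left h9 hL
  have := mul_le_mul_of_nonneg_left h4 hL
  linarith

/-- Change of the Lyapunov function `envelope + 2 L η F` along a projected step in a perturbed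
gradient direction. -/
theorem envelope_add_step_le {x z g w : E} {η : ℝ} (hη : 0 ≤ η) (hηL : 2 * L * η ≤ 1)
    (hx : x ∈ X) (hz : IsProx X F L x z) (hw : IsProj X (x - η • g) w) :
    envelope X F L w + 2 * L * η * F w ≤
      envelope X F L x + 2 * L * η * F x - η / 3 * bfbe X F (3 * L) x
      + inner ℝ ((-(2 * L * η)) • (x - z)) (g - gradient F x)
      + 2 * L * η ^ 2 * ‖g - gradient F x‖ ^ 2 := by
  have hL := h.nonneg
  have h1 := h.envelope_le w hz.1
  have h2 := hw.inner_le_zero h.convex hz.1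
  have h3 := h.le_add_inner hx hw.1
  have h4 := mul_le_mul_of_nonneg_left (h.bfbe_le_inner hx hz) hη
  set ξ := g - gradient F x with hξ
  -- Three-point identity. After multiplication by `2L`, the term in `⟨∇F(x), w - x⟩` cancels
  -- against the smoothness bound for `2LηF(w)`; this is why `2LηF` joins the envelope.
  have e : inner ℝ (x - η • g - w) (z - w) = (‖w - x‖ ^ 2 + ‖z - w‖ ^ 2 - ‖z - x‖ ^ 2) / 2
      + η * (inner ℝ (gradient F x) (w - x) + inner ℝ (gradient F x) (x - z)
      + inner ℝ ξ (w - x) + inner ℝ ξ (x - z)) := by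
    have key : ∀ u v G ζ : E, inner ℝ (-v - η • G - η • ζ) u =
        (‖v‖ ^ 2 + ‖u‖ ^ 2 - ‖u + v‖ ^ 2) / 2 + η * (inner ℝ G v + inner ℝ G (-(u + v))
          + inner ℝ ζ v + inner ℝ ζ (-(u + v))) := by
      intro u v G ζ
      rw [norm_add_sq_real]
      simp only [inner_sub_left, inner_add_right, inner_neg_left, inner_neg_right,
        real_inner_smul_left]
      rw [real_inner_comm v u]
      ring
    convert key (z - w) (w - x) (gradient F x) ξ using 2
    · rw [hξ]; module
    · rw [sub_add_sub_cancel]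
    · rw [sub_add_sub_cancel, neg_sub]
  rw [e] at h2
  -- The three-point identity leaves `-L ‖w - x‖²`; half of it absorbs this Young term and half the
  -- smoothness error `L²η ‖w - x‖²`.
  have h5 : -(η * inner ℝ ξ (w - x)) ≤ η ^ 2 * ‖ξ‖ ^ 2 + ‖w - x‖ ^ 2 / 4 := by
    have := sq_nonneg (η * ‖ξ‖ - ‖w - x‖ / 2)
    have h6 := mul_le_mul_of_nonneg_left
      ((neg_le_abs _).trans (abs_real_inner_le_norm ξ (w - x))) hη
    linarith
  have h6 : L * (2 * L * η) * ‖w - x‖ ^ 2 ≤ L * 1 * ‖w - x‖ ^ 2 := by gcongr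
  have h7 := mul_le_mul_of_nonneg_left h3 (mul_nonneg (mul_nonneg zero_le_two hL) hη)
  have h8 := mul_le_mul_of_nonneg_left h2 hL
  have h9 := mul_le_mul_of_nonneg_left h5 hL
  rw [hz.envelope_eq, real_inner_smul_left, real_inner_comm ξ (x - z)]
  linarith

end IsSmoothOver

end SmoothOptimization

/-! ### Occupancy weights, Bellman equation and performance difference -/

section MDPTheory

variable {S A : Type*} [Fintype S] [Fintype A]

/-- One step of the state dynamics under `π`, starting from the weights `D`. -/
def pushForward (M : MDP S A) (π : PolicySpace S A) (D : S → ℝ) (s' : S) : ℝ :=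
  ∑ s, ∑ a, D s * π (s, a) * M.trans s a s'

/-- The unnormalized discounted occupancy weights. -/
noncomputable def occupancy (M : MDP S A) (ν : S → ℝ) (π : PolicySpace S A) (s : S) : ℝ :=
  ∑' h : ℕ, M.γ ^ h * stateDist M ν π h s

theorem visitation_eq (M : MDP S A) (ν : S → ℝ) (π : PolicySpace S A) (s : S) :
    visitation M ν π s = (1 - M.γ) * occupancy M ν π s := rfl

theorem one_sub_gamma_pos (M : MDP S A) : 0 < 1 - M.γ := sub_pos.2 M.γ_lt_one

/-- A general row bound `b` is needed because differentiation leaves the simplex (rows of mass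
slightly above one) and because the dynamics are also applied to differences of policies. -/
theorem sum_abs_pushForward_le (M : MDP S A) {π : PolicySpace S A} {b : ℝ}
    (hb : ∀ s, ∑ a, |π (s, a)| ≤ b) (D : S → ℝ) :
    ∑ s', |pushForward M π D s'| ≤ b * ∑ s, |D s| := by
  calc ∑ s', |pushForward M π D s'| ≤ ∑ s', ∑ s, ∑ a, |D s| * |π (s, a)| * M.trans s a s' := by
        refine Finset.sum_le_sum fun s' _ => ?_
        refine (Finset.abs_sum_le_sum_abs _ _).trans (Finset.sum_le_sum fun s _ => ?_)
        refine (Finset.abs_sum_le_sum_abs _ _).trans (Finset.sum_le_sum fun a _ => ?_)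
        rw [abs_mul, abs_mul, abs_of_nonneg ((M.trans_mem s a).1 s')]
    _ = ∑ s, |D s| * ∑ a, |π (s, a)| := by
        rw [Finset.sum_comm]
        refine Finset.sum_congr rfl fun s _ => ?_
        rw [Finset.sum_comm, Finset.mul_sum]
        refine Finset.sum_congr rfl fun a _ => ?_
        rw [← Finset.mul_sum, (M.trans_mem s a).2, mul_one]
    _ ≤ b * ∑ s, |D s| := by
        rw [Finset.mul_sum]
        refine Finset.sum_le_sum fun s _ => ?_
        rw [mul_comm b]
        exact mul_le_mul_of_nonneg_left (hb s) (abs_nonneg _)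

/-- The flow equation is an `ℓ¹` contraction of factor `γ b`. It serves both for occupancy weights
and for their differences. -/
theorem sum_abs_le_of_eq_add_pushForward (M : MDP S A) {π : PolicySpace S A} {b : ℝ}
    (hb : ∀ s, ∑ a, |π (s, a)| ≤ b) {e c : S → ℝ}
    (he : ∀ s, e s = c s + M.γ * pushForward M π e s) :
    (1 - M.γ * b) * ∑ s, |e s| ≤ ∑ s, |c s| := by
  have h1 : ∑ s, |e s| ≤ ∑ s, (|c s| + M.γ * |pushForward M π e s|) := by
    refine Finset.sum_le_sum fun s _ => ?_
    calc |e s| = |c s + M.γ * pushForward M π e s| := by rw [← he s]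
      _ ≤ |c s| + |M.γ * pushForward M π e s| := abs_add_le _ _
      _ = _ := by rw [abs_mul, abs_of_nonneg M.γ_nonneg]
  rw [Finset.sum_add_distrib, ← Finset.mul_sum] at h1
  have h2 := mul_le_mul_of_nonneg_left (sum_abs_pushForward_le M hb e) M.γ_nonneg
  linarith

theorem sum_abs_stateDist_le (M : MDP S A) (ν : S → ℝ) {π : PolicySpace S A} {b : ℝ}
    (hb0 : 0 ≤ b) (hb : ∀ s, ∑ a, |π (s, a)| ≤ b) (h : ℕ) :
    ∑ s, |stateDist M ν π h s| ≤ b ^ h * ∑ s, |ν s| := by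
  induction h with
  | zero => simp [stateDist]
  | succ h ih =>
    refine (sum_abs_pushForward_le M hb (stateDist M ν π h)).trans ?_
    rw [pow_succ', mul_assoc]
    exact mul_le_mul_of_nonneg_left ih hb0

theorem summable_stateDist (M : MDP S A) (ν : S → ℝ) {π : PolicySpace S A} {b : ℝ}
    (hb0 : 0 ≤ b) (hb : ∀ s, ∑ a, |π (s, a)| ≤ b) (hγ : M.γ * b < 1) (s : S) :
    Summable fun h : ℕ => M.γ ^ h * stateDist M ν π h s := by
  have hg := (summable_geometric_of_lt_one (mul_nonneg M.γ_nonneg hb0) hγ).mul_right (∑ s, |ν s|)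
  refine Summable.of_norm_bounded hg fun h => ?_
  rw [Real.norm_eq_abs, abs_mul, abs_of_nonneg (pow_nonneg M.γ_nonneg h), mul_pow, mul_assoc]
  refine mul_le_mul_of_nonneg_left ?_ (pow_nonneg M.γ_nonneg h)
  exact (Finset.single_le_sum (f := fun s => |stateDist M ν π h s|)
    (fun _ _ => abs_nonneg _) (Finset.mem_univ s)).trans (sum_abs_stateDist_le M ν hb0 hb h)

theorem occupancy_eq (M : MDP S A) (ν : S → ℝ) {π : PolicySpace S A} {b : ℝ}
    (hb0 : 0 ≤ b) (hb : ∀ s, ∑ a, |π (s, a)| ≤ b) (hγ : M.γ * b < 1) (s' : S) :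
    occupancy M ν π s' = ν s' + M.γ * pushForward M π (occupancy M ν π) s' := by
  have hs := summable_stateDist M ν hb0 hb hγ
  have h1 := (hs s').tsum_eq_zero_add
  rw [occupancy, h1]
  congr 1
  · simp [stateDist]
  have h2 : HasSum (fun h : ℕ => M.γ * ∑ s, ∑ a,
      (M.γ ^ h * stateDist M ν π h s) * π (s, a) * M.trans s a s')
      (M.γ * pushForward M π (occupancy M ν π) s') :=
    (hasSum_sum fun s _ => hasSum_sum fun a _ =>
      ((hs s).hasSum.mul_right (π (s, a))).mul_right (M.trans s a s')).mul_left _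
  rw [← h2.tsum_eq]
  refine tsum_congr fun h => ?_
  simp only [stateDist, Finset.mul_sum]
  refine Finset.sum_congr rfl fun s _ => Finset.sum_congr rfl fun a _ => ?_
  ring

theorem value_eq (M : MDP S A) (ν : S → ℝ) {π : PolicySpace S A} {b : ℝ}
    (hb0 : 0 ≤ b) (hb : ∀ s, ∑ a, |π (s, a)| ≤ b) (hγ : M.γ * b < 1) :
    value M ν π = -∑ s, ∑ a, occupancy M ν π s * π (s, a) * M.reward s a := by
  have hs := summable_stateDist M ν hb0 hb hγ
  have h2 : HasSum (fun h : ℕ => ∑ s, ∑ a,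
      (M.γ ^ h * stateDist M ν π h s) * π (s, a) * M.reward s a)
      (∑ s, ∑ a, occupancy M ν π s * π (s, a) * M.reward s a) :=
    hasSum_sum fun s _ => hasSum_sum fun a _ =>
      ((hs s).hasSum.mul_right (π (s, a))).mul_right (M.reward s a)
  rw [value, ← h2.tsum_eq]
  congr 1
  refine tsum_congr fun h => ?_
  simp only [expReward, Finset.mul_sum]
  refine Finset.sum_congr rfl fun s _ => Finset.sum_congr rfl fun a _ => ?_
  ring

theorem sum_abs_of_mem_policies {π : PolicySpace S A} (hπ : π ∈ policies S A) (s : S) :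
    ∑ a, |π (s, a)| = 1 := by
  rw [← (hπ s).2]
  exact Finset.sum_congr rfl fun a _ => abs_of_nonneg ((hπ s).1 a)

theorem sum_abs_le_one_of_mem_policies {π : PolicySpace S A} (hπ : π ∈ policies S A) (s : S) :
    ∑ a, |π (s, a)| ≤ 1 := (sum_abs_of_mem_policies hπ s).le

theorem gamma_mul_one_lt (M : MDP S A) : M.γ * 1 < 1 := by simpa using M.γ_lt_one

theorem stateDist_nonneg (M : MDP S A) {ν : S → ℝ} (hν : ∀ s, 0 ≤ ν s) {π : PolicySpace S A}
    (hπ : π ∈ policies S A) (h : ℕ) (s : S) : 0 ≤ stateDist M ν π h s := by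
  induction h generalizing s with
  | zero => exact hν s
  | succ h ih =>
    exact Finset.sum_nonneg fun s' _ => Finset.sum_nonneg fun a _ =>
      mul_nonneg (mul_nonneg (ih s') ((hπ s').1 a)) ((M.trans_mem s' a).1 s)

theorem occupancy_nonneg (M : MDP S A) {ν : S → ℝ} (hν : ∀ s, 0 ≤ ν s) {π : PolicySpace S A}
    (hπ : π ∈ policies S A) (s : S) : 0 ≤ occupancy M ν π s :=
  tsum_nonneg fun h => mul_nonneg (pow_nonneg M.γ_nonneg h) (stateDist_nonneg M hν hπ h s)

theorem le_occupancy (M : MDP S A) {ν : S → ℝ} (hν : ∀ s, 0 ≤ ν s) {π : PolicySpace S A}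
    (hπ : π ∈ policies S A) (s : S) : ν s ≤ occupancy M ν π s := by
  have h1 := (summable_stateDist M ν zero_le_one (sum_abs_le_one_of_mem_policies hπ)
    (gamma_mul_one_lt M) s).le_tsum 0 fun h _ =>
      mul_nonneg (pow_nonneg M.γ_nonneg h) (stateDist_nonneg M hν hπ h s)
  simpa [stateDist, occupancy] using h1

theorem sum_abs_eq_one_of_mem_stdSimplex {ν : S → ℝ} (hν : ν ∈ stdSimplex ℝ S) :
    ∑ s, |ν s| = 1 := by
  rw [← hν.2]
  exact Finset.sum_congr rfl fun s _ => abs_of_nonneg (hν.1 s)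

theorem sum_abs_occupancy_le (M : MDP S A) {ν : S → ℝ} (hν : ν ∈ stdSimplex ℝ S)
    {π : PolicySpace S A} (hπ : π ∈ policies S A) :
    ∑ s, |occupancy M ν π s| ≤ 1 / (1 - M.γ) := by
  have h := sum_abs_le_of_eq_add_pushForward M (sum_abs_le_one_of_mem_policies hπ)
    (occupancy_eq M ν zero_le_one (sum_abs_le_one_of_mem_policies hπ) (gamma_mul_one_lt M))
  rw [sum_abs_eq_one_of_mem_stdSimplex hν, mul_one] at h
  rw [le_div_iff₀ (one_sub_gamma_pos M)]
  linarith

/-- The total mass of the visitation distribution is one. -/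
theorem sum_visitation (M : MDP S A) {ν : S → ℝ} (hν : ν ∈ stdSimplex ℝ S)
    {π : PolicySpace S A} (hπ : π ∈ policies S A) : ∑ s, visitation M ν π s = 1 := by
  have h := occupancy_eq M ν zero_le_one (sum_abs_le_one_of_mem_policies hπ) (gamma_mul_one_lt M)
  have h1 : ∑ s', pushForward M π (occupancy M ν π) s' = ∑ s, occupancy M ν π s := by
    simp only [pushForward]
    rw [Finset.sum_comm]
    refine Finset.sum_congr rfl fun s _ => ?_
    rw [Finset.sum_comm]
    simp only [← Finset.mul_sum, (M.trans_mem s _).2, mul_one, (hπ s).2]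
  have h2 : ∑ s, occupancy M ν π s = 1 + M.γ * ∑ s, occupancy M ν π s := by
    conv_lhs => rw [Finset.sum_congr rfl fun s _ => h s]
    rw [Finset.sum_add_distrib, hν.2, ← Finset.mul_sum, h1]
  simp only [visitation_eq, ← Finset.mul_sum]
  linarith

/-- A maximum principle for discounted averages under a policy. -/
theorem abs_le_of_le_add_average (M : MDP S A) {π : PolicySpace S A} (hπ : π ∈ policies S A)
    {w : S → ℝ} {c : ℝ}
    (hw : ∀ s, |w s| ≤ c + M.γ * |∑ a, π (s, a) * ∑ s', M.trans s a s' * w s'|) (s : S) :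
    |w s| ≤ c / (1 - M.γ) := by
  have : Nonempty S := ⟨s⟩
  obtain ⟨m, hm⟩ := Finite.exists_max fun s => |w s|
  refine (hm s).trans ?_
  rw [le_div_iff₀ (one_sub_gamma_pos M)]
  have h1 : |∑ a, π (m, a) * ∑ s', M.trans m a s' * w s'| ≤ |w m| := by
    calc |∑ a, π (m, a) * ∑ s', M.trans m a s' * w s'|
        ≤ ∑ a, π (m, a) * |w m| := by
          refine (Finset.abs_sum_le_sum_abs _ _).trans (Finset.sum_le_sum fun a _ => ?_)
          rw [abs_mul, abs_of_nonneg ((hπ m).1 a)]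
          refine mul_le_mul_of_nonneg_left ?_ ((hπ m).1 a)
          calc |∑ s', M.trans m a s' * w s'| ≤ ∑ s', M.trans m a s' * |w m| := by
                refine (Finset.abs_sum_le_sum_abs _ _).trans (Finset.sum_le_sum fun s' _ => ?_)
                rw [abs_mul, abs_of_nonneg ((M.trans_mem m a).1 s')]
                exact mul_le_mul_of_nonneg_left (hm s') ((M.trans_mem m a).1 s')
            _ = |w m| := by rw [← Finset.sum_mul, (M.trans_mem m a).2, one_mul]
      _ = |w m| := by rw [← Finset.sum_mul, (hπ m).2, one_mul]
  have h2 := mul_le_mul_of_nonneg_left h1 M.γ_nonneg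
  have h3 := hw m
  linarith

open Classical in
/-- The reward-to-go from each state, as the solution of the Bellman equation. -/
noncomputable def stateValue (M : MDP S A) (π : PolicySpace S A) : S → ℝ :=
  (1 - M.γ • Matrix.of fun s s' => ∑ a, π (s, a) * M.trans s a s' : Matrix S S ℝ)⁻¹.mulVec
    fun s => ∑ a, π (s, a) * M.reward s a

/-- The reward-to-go from each state-action pair. -/
noncomputable def actionValue (M : MDP S A) (π : PolicySpace S A) (s : S) (a : A) : ℝ :=
  M.reward s a + M.γ * ∑ s', M.trans s a s' * stateValue M π s'

theorem stateValue_eq (M : MDP S A) {π : PolicySpace S A} (hπ : π ∈ policies S A) (s : S) :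
    stateValue M π s = ∑ a, π (s, a) * actionValue M π s a := by
  classical
  set B : Matrix S S ℝ := Matrix.of fun s s' => ∑ a, π (s, a) * M.trans s a s' with hB
  have hBw : ∀ (w : S → ℝ) s, B.mulVec w s = ∑ a, π (s, a) * ∑ s', M.trans s a s' * w s' := by
    intro w s
    simp only [hB, Matrix.mulVec, dotProduct, Matrix.of_apply, Finset.sum_mul, Finset.mul_sum]
    rw [Finset.sum_comm]
    simp only [mul_assoc]
  -- A kernel vector would violate the maximum principle with `c = 0`; hence the matrix inverse in
  -- `stateValue` is genuine, not the default value.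
  have hdet : (1 - M.γ • B).det ≠ 0 := by
    intro h0
    obtain ⟨w, hw0, hw⟩ := Matrix.exists_mulVec_eq_zero_iff.2 h0
    refine hw0 (funext fun s => ?_)
    have h1 := abs_le_of_le_add_average M hπ (w := w) (c := 0) (fun s => by
      have h2 := congrFun hw s
      rw [Matrix.sub_mulVec, Matrix.one_mulVec, Matrix.smul_mulVec, Pi.sub_apply, Pi.smul_apply,
        hBw, smul_eq_mul, Pi.zero_apply, sub_eq_zero] at h2
      rw [zero_add]
      conv_lhs => rw [h2]
      rw [abs_mul, abs_of_nonneg M.γ_nonneg]) s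
    rw [zero_div] at h1
    exact abs_nonpos_iff.1 h1
  have h3 : (1 - M.γ • B).mulVec (stateValue M π) = fun s => ∑ a, π (s, a) * M.reward s a := by
    have e : stateValue M π = (1 - M.γ • B)⁻¹.mulVec fun s => ∑ a, π (s, a) * M.reward s a := by
      rw [stateValue]
    rw [e, Matrix.mulVec_mulVec, Matrix.mul_nonsing_inv _ (isUnit_iff_ne_zero.2 hdet),
      Matrix.one_mulVec]
  have h4 := congrFun h3 s
  rw [Matrix.sub_mulVec, Matrix.one_mulVec, Matrix.smul_mulVec, Pi.sub_apply, Pi.smul_apply,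
    hBw, smul_eq_mul] at h4
  simp only [actionValue, mul_add, Finset.sum_add_distrib]
  rw [← h4, Finset.mul_sum]
  have : ∀ a, π (s, a) * (M.γ * ∑ s', M.trans s a s' * stateValue M π s') =
      M.γ * (π (s, a) * ∑ s', M.trans s a s' * stateValue M π s') := fun a => by ring
  simp only [this]
  ring

theorem abs_stateValue_le (M : MDP S A) {π : PolicySpace S A} (hπ : π ∈ policies S A) (s : S) :
    |stateValue M π s| ≤ 1 / (1 - M.γ) := by
  refine abs_le_of_le_add_average M hπ (fun s => ?_) s
  have h1 : stateValue M π s = ∑ a, π (s, a) * M.reward s a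
      + M.γ * ∑ a, π (s, a) * ∑ s', M.trans s a s' * stateValue M π s' := by
    rw [stateValue_eq M hπ s, Finset.mul_sum, ← Finset.sum_add_distrib]
    refine Finset.sum_congr rfl fun a _ => ?_
    rw [actionValue]; ring
  have h2 : |∑ a, π (s, a) * M.reward s a| ≤ 1 := by
    rw [← (hπ s).2]
    refine (Finset.abs_sum_le_sum_abs _ _).trans (Finset.sum_le_sum fun a _ => ?_)
    have hr := M.reward_mem s a
    rw [abs_of_nonneg (mul_nonneg ((hπ s).1 a) hr.1)]
    exact mul_le_of_le_one_right ((hπ s).1 a) hr.2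
  conv_lhs => rw [h1]
  refine (abs_add_le _ _).trans ?_
  rw [abs_mul, abs_of_nonneg M.γ_nonneg]
  gcongr

theorem abs_sum_trans_mul_le (M : MDP S A) {w : S → ℝ} {c : ℝ} (hw : ∀ s, |w s| ≤ c) (s : S)
    (a : A) : |∑ s', M.trans s a s' * w s'| ≤ c := by
  calc |∑ s', M.trans s a s' * w s'| ≤ ∑ s', M.trans s a s' * c := by
        refine (Finset.abs_sum_le_sum_abs _ _).trans (Finset.sum_le_sum fun s' _ => ?_)
        rw [abs_mul, abs_of_nonneg ((M.trans_mem s a).1 s')]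
        exact mul_le_mul_of_nonneg_left (hw s') ((M.trans_mem s a).1 s')
    _ = c := by rw [← Finset.sum_mul, (M.trans_mem s a).2, one_mul]

theorem abs_actionValue_le (M : MDP S A) {π : PolicySpace S A} (hπ : π ∈ policies S A) (s : S)
    (a : A) : |actionValue M π s a| ≤ 1 / (1 - M.γ) := by
  have hr := M.reward_mem s a
  have h1 := abs_sum_trans_mul_le M (abs_stateValue_le M hπ) s a
  have h2 : 1 / (1 - M.γ) = 1 + M.γ * (1 / (1 - M.γ)) := by
    field_simp [(one_sub_gamma_pos M).ne']
    ring
  rw [h2, actionValue]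
  refine (abs_add_le _ _).trans ?_
  rw [abs_mul, abs_of_nonneg M.γ_nonneg, abs_of_nonneg hr.1]
  have := mul_le_mul_of_nonneg_left h1 M.γ_nonneg
  linarith [hr.2]

/-- Occupancy weights integrate the Bellman equation. -/
theorem sum_occupancy_mul_reward (M : MDP S A) (ν : S → ℝ) {π π' : PolicySpace S A} {b : ℝ}
    (hb0 : 0 ≤ b) (hb : ∀ s, ∑ a, |π' (s, a)| ≤ b) (hγ : M.γ * b < 1) :
    ∑ s, ∑ a, occupancy M ν π' s * π' (s, a) * M.reward s a =
      ∑ s, ν s * stateValue M π s + ∑ s, occupancy M ν π' s *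
        (∑ a, π' (s, a) * actionValue M π s a - stateValue M π s) := by
  have h := occupancy_eq M ν hb0 hb hγ
  have h1 : ∑ s, occupancy M ν π' s * stateValue M π s = ∑ s, ν s * stateValue M π s
      + M.γ * ∑ s', pushForward M π' (occupancy M ν π') s' * stateValue M π s' := by
    conv_lhs => rw [Finset.sum_congr rfl fun s _ => by rw [h s]]
    rw [Finset.mul_sum, ← Finset.sum_add_distrib]
    exact Finset.sum_congr rfl fun s _ => by ring
  have h2 : ∑ s', pushForward M π' (occupancy M ν π') s' * stateValue M π s' =
      ∑ s, ∑ a, occupancy M ν π' s * π' (s, a) * ∑ s', M.trans s a s' * stateValue M π s' := by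
    simp only [pushForward, Finset.sum_mul, Finset.mul_sum]
    rw [Finset.sum_comm]
    refine Finset.sum_congr rfl fun s _ => ?_
    rw [Finset.sum_comm]
    refine Finset.sum_congr rfl fun a _ => Finset.sum_congr rfl fun s' _ => ?_
    ring
  have h3 : ∑ s, occupancy M ν π' s *
        (∑ a, π' (s, a) * actionValue M π s a - stateValue M π s) =
      ∑ s, ∑ a, occupancy M ν π' s * π' (s, a) * M.reward s a
      + M.γ * ∑ s, ∑ a, occupancy M ν π' s * π' (s, a) *
        ∑ s', M.trans s a s' * stateValue M π s'
      - ∑ s, occupancy M ν π' s * stateValue M π s := by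
    rw [Finset.mul_sum, ← Finset.sum_add_distrib, ← Finset.sum_sub_distrib]
    refine Finset.sum_congr rfl fun s _ => ?_
    rw [Finset.mul_sum, ← Finset.sum_add_distrib, mul_sub, Finset.mul_sum]
    congr 1
    refine Finset.sum_congr rfl fun a _ => ?_
    rw [actionValue]
    ring
  rw [h3, h1, h2]
  ring

/-- The performance difference identity. -/
theorem value_sub_value (M : MDP S A) (ν : S → ℝ) {π π' : PolicySpace S A} {b : ℝ}
    (hπ : π ∈ policies S A) (hb0 : 0 ≤ b) (hb : ∀ s, ∑ a, |π' (s, a)| ≤ b) (hγ : M.γ * b < 1) :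
    value M ν π' - value M ν π = -∑ s, occupancy M ν π' s *
      ∑ a, (π' (s, a) - π (s, a)) * actionValue M π s a := by
  have hπ1 := sum_abs_le_one_of_mem_policies hπ
  rw [value_eq M ν hb0 hb hγ, value_eq M ν zero_le_one hπ1 (gamma_mul_one_lt M),
    sum_occupancy_mul_reward M ν (π := π) hb0 hb hγ,
    sum_occupancy_mul_reward M ν (π := π) zero_le_one hπ1 (gamma_mul_one_lt M)]
  -- The Bellman equation of `π` removes its own correction term. Only `π` has to be a policy; `π'`
  -- may leave the simplex.
  have h1 : ∑ s, occupancy M ν π s *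
      (∑ a, π (s, a) * actionValue M π s a - stateValue M π s) = 0 :=
    Finset.sum_eq_zero fun s _ => by rw [← stateValue_eq M hπ s, sub_self, mul_zero]
  rw [h1]
  simp only [sub_mul, Finset.sum_sub_distrib, ← stateValue_eq M hπ]
  ring

end MDPTheory

/-! ### The policy gradient, its Lipschitz constant and gradient domination -/

section PolicyGradient

variable {S A : Type*} [Fintype S] [Fintype A]

theorem norm_sq_eq_sum (x : PolicySpace S A) : ‖x‖ ^ 2 = ∑ s, ∑ a, x (s, a) ^ 2 := by
  rw [EuclideanSpace.real_norm_sq_eq, Fintype.sum_prod_type]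

theorem inner_eq_sum (x y : PolicySpace S A) : inner ℝ x y = ∑ s, ∑ a, x (s, a) * y (s, a) := by
  rw [PiLp.inner_apply, Fintype.sum_prod_type]
  refine Finset.sum_congr rfl fun s _ => Finset.sum_congr rfl fun a _ => ?_
  simp [mul_comm]

theorem sum_abs_row_le (x : PolicySpace S A) (s : S) :
    ∑ a, |x (s, a)| ≤ √(Fintype.card A) * ‖x‖ := by
  refine le_of_sq_le_sq ?_ (by positivity)
  rw [mul_pow, Real.sq_sqrt (Nat.cast_nonneg _), norm_sq_eq_sum]
  refine (sq_sum_le_card_mul_sum_sq (s := Finset.univ) (f := fun a => |x (s, a)|)).trans ?_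
  rw [Finset.card_univ]
  refine mul_le_mul_of_nonneg_left ?_ (Nat.cast_nonneg _)
  simp only [sq_abs]
  exact Finset.single_le_sum (f := fun s => ∑ a, x (s, a) ^ 2)
    (fun _ _ => Finset.sum_nonneg fun _ _ => sq_nonneg _) (Finset.mem_univ s)

/-- Over states, `ℓ²` is bounded by `ℓ¹`, so only `√|A|` appears; this keeps `|S|` out of `L_F`. -/
theorem norm_le_of_abs_le_mul {x : PolicySpace S A} {u : S → ℝ} {c : ℝ} (hc : 0 ≤ c)
    (h : ∀ s a, |x (s, a)| ≤ |u s| * c) :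
    ‖x‖ ≤ √(Fintype.card A) * c * ∑ s, |u s| := by
  have hu : 0 ≤ ∑ s, |u s| := Finset.sum_nonneg fun _ _ => abs_nonneg _
  refine le_of_sq_le_sq ?_ (by positivity)
  rw [norm_sq_eq_sum, mul_pow, mul_pow, Real.sq_sqrt (Nat.cast_nonneg _)]
  calc ∑ s, ∑ a, x (s, a) ^ 2 ≤ ∑ s, ∑ _a : A, (|u s| * c) ^ 2 := by
        refine Finset.sum_le_sum fun s _ => Finset.sum_le_sum fun a _ => ?_
        rw [← sq_abs]
        exact pow_le_pow_left₀ (abs_nonneg _) (h s a) 2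
    _ = Fintype.card A * c ^ 2 * ∑ s, |u s| ^ 2 := by
        simp only [Finset.sum_const, Finset.card_univ, nsmul_eq_mul]
        rw [Finset.mul_sum]
        exact Finset.sum_congr rfl fun s _ => by ring
    _ ≤ Fintype.card A * c ^ 2 * (∑ s, |u s|) ^ 2 := by
        refine mul_le_mul_of_nonneg_left ?_ (by positivity)
        exact Finset.sum_sq_le_sq_sum_of_nonneg fun s _ => abs_nonneg _

theorem convex_policies : Convex ℝ (policies S A) := by
  intro π hπ π' hπ' α β hα hβ hαβ s
  exact convex_stdSimplex ℝ A (hπ s) (hπ' s) hα hβ hαβ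

/-- Entries in `[0, 1]` satisfy `(a - b)² ≤ a + b`, and the two rows sum to `2`. -/
theorem norm_sub_sq_le_of_mem_policies {π π' : PolicySpace S A} (hπ : π ∈ policies S A)
    (hπ' : π' ∈ policies S A) : ‖π - π'‖ ^ 2 ≤ 2 * Fintype.card S := by
  rw [norm_sq_eq_sum]
  calc ∑ s, ∑ a, (π - π') (s, a) ^ 2 ≤ ∑ _s : S, (2 : ℝ) := by
        refine Finset.sum_le_sum fun s _ => ?_
        have h2 : (2 : ℝ) = ∑ a, (π (s, a) + π' (s, a)) := by
          rw [Finset.sum_add_distrib, (hπ s).2, (hπ' s).2]; norm_num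
        rw [h2]
        refine Finset.sum_le_sum fun a _ => ?_
        have e1 : ∀ {ρ : PolicySpace S A}, ρ ∈ policies S A → ρ (s, a) ≤ 1 := fun {ρ} hρ => by
          rw [← (hρ s).2]
          exact Finset.single_le_sum (f := fun a => ρ (s, a)) (fun a _ => (hρ s).1 a)
            (Finset.mem_univ a)
        have h3 := (hπ s).1 a
        have h4 := (hπ' s).1 a
        have h5 := e1 hπ
        have h6 := e1 hπ'
        simp only [PiLp.sub_apply] at *
        nlinarith [mul_nonneg h3 h4]
    _ = 2 * Fintype.card S := by
        rw [Finset.sum_const, Finset.card_univ, nsmul_eq_mul, mul_comm]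

theorem isCompact_policies : IsCompact (policies S A) := by
  have hc : IsClosed (policies S A) := by
    have : policies S A = ⋂ s, (fun π : PolicySpace S A => fun a => π (s, a)) ⁻¹' stdSimplex ℝ A := by
      ext π; simp [policies]
    rw [this]
    exact isClosed_iInter fun s => (isClosed_stdSimplex ℝ A).preimage (by fun_prop)
  refine Metric.isCompact_of_isClosed_isBounded hc ?_
  refine Metric.isBounded_iff.2 ⟨√(2 * Fintype.card S), fun π hπ π' hπ' => ?_⟩
  rw [dist_eq_norm]
  exact Real.le_sqrt_of_sq_le (norm_sub_sq_le_of_mem_policies hπ hπ')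

/-- Perturbation of the occupancy weights. -/
theorem sum_abs_occupancy_sub_le (M : MDP S A) {ν : S → ℝ} (hν : ν ∈ stdSimplex ℝ S)
    {π π' : PolicySpace S A} {b : ℝ} (hπ : π ∈ policies S A) (hb0 : 0 ≤ b)
    (hb : ∀ s, ∑ a, |π' (s, a)| ≤ b) (hγ : M.γ * b < 1) :
    (1 - M.γ * b) * ∑ s, |occupancy M ν π' s - occupancy M ν π s| ≤
      M.γ * √(Fintype.card A) / (1 - M.γ) * ‖π' - π‖ := by
  have hπ1 := sum_abs_le_one_of_mem_policies hπ
  -- The difference solves the flow equation of `π'`, with source the change of dynamics applied to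
  -- the occupancy of `π`.
  have h := sum_abs_le_of_eq_add_pushForward M hb
    (e := fun s => occupancy M ν π' s - occupancy M ν π s)
    (c := fun s => M.γ * pushForward M (π' - π) (occupancy M ν π) s) (fun s => by
      rw [occupancy_eq M ν hb0 hb hγ s, occupancy_eq M ν zero_le_one hπ1 (gamma_mul_one_lt M) s]
      have e : pushForward M π' (occupancy M ν π') s - pushForward M π (occupancy M ν π) s =
          pushForward M (π' - π) (occupancy M ν π) s
          + pushForward M π' (fun s => occupancy M ν π' s - occupancy M ν π s) s := by
        simp only [pushForward, ← Finset.sum_sub_distrib, ← Finset.sum_add_distrib]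
        refine Finset.sum_congr rfl fun s _ => Finset.sum_congr rfl fun a _ => ?_
        simp only [PiLp.sub_apply]
        ring
      linear_combination M.γ * e)
  refine h.trans ?_
  simp only [abs_mul, abs_of_nonneg M.γ_nonneg, ← Finset.mul_sum]
  have h1 := sum_abs_pushForward_le M (sum_abs_row_le (π' - π)) (occupancy M ν π)
  have h2 := h1.trans (mul_le_mul_of_nonneg_left (sum_abs_occupancy_le M hν hπ) (by positivity))
  refine (mul_le_mul_of_nonneg_left h2 M.γ_nonneg).trans (le_of_eq ?_)
  ring

theorem abs_sum_mul_actionValue_le (M : MDP S A) {π : PolicySpace S A} (hπ : π ∈ policies S A)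
    (x : PolicySpace S A) (s : S) :
    |∑ a, x (s, a) * actionValue M π s a| ≤ √(Fintype.card A) * ‖x‖ / (1 - M.γ) := by
  calc |∑ a, x (s, a) * actionValue M π s a| ≤ ∑ a, |x (s, a)| * (1 / (1 - M.γ)) := by
        refine (Finset.abs_sum_le_sum_abs _ _).trans (Finset.sum_le_sum fun a _ => ?_)
        rw [abs_mul]
        exact mul_le_mul_of_nonneg_left (abs_actionValue_le M hπ s a) (abs_nonneg _)
    _ ≤ (√(Fintype.card A) * ‖x‖) * (1 / (1 - M.γ)) := by
        rw [← Finset.sum_mul]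
        exact mul_le_mul_of_nonneg_right (sum_abs_row_le x s)
          (one_div_pos.2 (one_sub_gamma_pos M)).le
    _ = _ := by ring

theorem abs_actionValue_sub_le (M : MDP S A) {π π' : PolicySpace S A} (hπ : π ∈ policies S A)
    (hπ' : π' ∈ policies S A) (s : S) (a : A) :
    |actionValue M π' s a - actionValue M π s a| ≤
      M.γ * (√(Fintype.card A) * ‖π' - π‖ / (1 - M.γ) / (1 - M.γ)) := by
  have e : ∀ s a, actionValue M π' s a - actionValue M π s a =
      M.γ * ∑ s', M.trans s a s' * (stateValue M π' s' - stateValue M π s') := fun s a => by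
    simp only [actionValue, mul_sub, Finset.sum_sub_distrib]
    ring
  have h1 := abs_le_of_le_add_average M hπ' (w := fun s => stateValue M π' s - stateValue M π s)
    (c := √(Fintype.card A) * ‖π' - π‖ / (1 - M.γ)) (fun s => by
      have e1 : stateValue M π' s - stateValue M π s =
          ∑ a, (π' - π) (s, a) * actionValue M π s a
          + M.γ * ∑ a, π' (s, a) * ∑ s', M.trans s a s' *
            (stateValue M π' s' - stateValue M π s') := by
        rw [stateValue_eq M hπ', stateValue_eq M hπ, Finset.mul_sum, ← Finset.sum_add_distrib,
          ← Finset.sum_sub_distrib]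
        refine Finset.sum_congr rfl fun a _ => ?_
        rw [PiLp.sub_apply]
        linear_combination π' (s, a) * e s a
      conv_lhs => rw [e1]
      refine (abs_add_le _ _).trans ?_
      rw [abs_mul M.γ, abs_of_nonneg M.γ_nonneg]
      have := abs_sum_mul_actionValue_le M hπ (π' - π) s
      linarith)
  rw [e, abs_mul, abs_of_nonneg M.γ_nonneg]
  exact mul_le_mul_of_nonneg_left (abs_sum_trans_mul_le M h1 s a) M.γ_nonneg

/-- The policy gradient in the direct parametrization. -/
noncomputable def policyGradient (M : MDP S A) (ν : S → ℝ) (π : PolicySpace S A) :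
    PolicySpace S A :=
  WithLp.toLp 2 fun x => -(occupancy M ν π x.1 * actionValue M π x.1 x.2)

theorem inner_policyGradient (M : MDP S A) (ν : S → ℝ) (π x : PolicySpace S A) :
    inner ℝ (policyGradient M ν π) x =
      -∑ s, occupancy M ν π s * ∑ a, x (s, a) * actionValue M π s a := by
  rw [inner_eq_sum, ← Finset.sum_neg_distrib]
  refine Finset.sum_congr rfl fun s _ => ?_
  rw [Finset.mul_sum, ← Finset.sum_neg_distrib]
  refine Finset.sum_congr rfl fun a _ => ?_
  simp only [policyGradient]
  ring

/-- The policy gradient theorem. -/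
theorem hasGradientAt_value (M : MDP S A) {ν : S → ℝ} (hν : ν ∈ stdSimplex ℝ S)
    {π : PolicySpace S A} (hπ : π ∈ policies S A) :
    HasGradientAt (value M ν) (policyGradient M ν π) π := by
  have hγ := one_sub_gamma_pos M
  set c := √(Fintype.card A : ℝ) with hc
  have hc0 : 0 ≤ c := Real.sqrt_nonneg _
  have hO : (fun π' => value M ν π' - inner ℝ (policyGradient M ν π) (π' - π)
      - value M ν π) =O[nhds π] fun π' => ‖π' - π‖ ^ 2 := by
    refine Asymptotics.IsBigO.of_bound
      (2 / (1 - M.γ) * (M.γ * c / (1 - M.γ)) * (c / (1 - M.γ))) ?_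
    -- Close to `π` the rows have mass `1 + δ` with `γ (1 + δ) < 1`, so the series still converges.
    have hball : ∀ᶠ π' in nhds π, c * ‖π' - π‖ < (1 - M.γ) / 2 := by
      have : Filter.Tendsto (fun π' => c * ‖π' - π‖) (nhds π) (nhds (c * ‖π - π‖)) := by
        refine Continuous.tendsto ?_ π
        fun_prop
      refine this.eventually_lt_const ?_
      rw [sub_self, norm_zero, mul_zero]
      linarith
    filter_upwards [hball] with π' hπ'
    set δ := c * ‖π' - π‖ with hδ
    have hδ0 : 0 ≤ δ := by positivity
    have hb : ∀ s, ∑ a, |π' (s, a)| ≤ 1 + δ := fun s => by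
      calc ∑ a, |π' (s, a)| ≤ ∑ a, (|π (s, a)| + |(π' - π) (s, a)|) := by
            refine Finset.sum_le_sum fun a _ => ?_
            have := abs_add_le (π (s, a)) ((π' - π) (s, a))
            rwa [PiLp.sub_apply, add_sub_cancel] at this
        _ ≤ 1 + δ := by
            rw [Finset.sum_add_distrib, sum_abs_of_mem_policies hπ s]
            exact add_le_add_right (sum_abs_row_le (π' - π) s) 1
    have hγb : (1 - M.γ) / 2 ≤ 1 - M.γ * (1 + δ) := by
      nlinarith [M.γ_nonneg, M.γ_lt_one]
    have hγb1 : M.γ * (1 + δ) < 1 := by linarith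
    have h1 := value_sub_value M ν hπ (by linarith : (0 : ℝ) ≤ 1 + δ) hb hγb1
    have h2 := sum_abs_occupancy_sub_le M hν hπ (by linarith : (0 : ℝ) ≤ 1 + δ) hb hγb1
    set Δ := ∑ s, |occupancy M ν π' s - occupancy M ν π s| with hΔ
    have hΔ0 : 0 ≤ Δ := Finset.sum_nonneg fun _ _ => abs_nonneg _
    have h3 : Δ ≤ 2 / (1 - M.γ) * (M.γ * c / (1 - M.γ)) * ‖π' - π‖ := by
      have := (mul_le_mul_of_nonneg_right hγb hΔ0).trans h2
      have h5 := mul_le_mul_of_nonneg_left this (by positivity : 0 ≤ 2 / (1 - M.γ))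
      calc Δ = 2 / (1 - M.γ) * ((1 - M.γ) / 2 * Δ) := by field_simp
        _ ≤ _ := h5
        _ = _ := by ring
    -- By performance difference, the remainder is the change of occupancy times the change of
    -- policy, hence quadratic.
    have h4 : value M ν π' - inner ℝ (policyGradient M ν π) (π' - π) - value M ν π =
        -∑ s, (occupancy M ν π' s - occupancy M ν π s) *
          ∑ a, (π' - π) (s, a) * actionValue M π s a := by
      rw [inner_policyGradient]
      simp only [sub_mul (occupancy M ν π' _), Finset.sum_sub_distrib, PiLp.sub_apply] at h1 ⊢
      linear_combination h1
    rw [h4, norm_neg, Real.norm_eq_abs, Real.norm_of_nonneg (sq_nonneg _)]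
    calc |∑ s, (occupancy M ν π' s - occupancy M ν π s) *
          ∑ a, (π' - π) (s, a) * actionValue M π s a|
        ≤ ∑ s, |occupancy M ν π' s - occupancy M ν π s| * (c * ‖π' - π‖ / (1 - M.γ)) := by
          refine (Finset.abs_sum_le_sum_abs _ _).trans (Finset.sum_le_sum fun s _ => ?_)
          rw [abs_mul]
          exact mul_le_mul_of_nonneg_left (abs_sum_mul_actionValue_le M hπ _ s) (abs_nonneg _)
      _ = Δ * (c * ‖π' - π‖ / (1 - M.γ)) := by rw [← Finset.sum_mul]
      _ ≤ 2 / (1 - M.γ) * (M.γ * c / (1 - M.γ)) * ‖π' - π‖ * (c * ‖π' - π‖ / (1 - M.γ)) :=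
          mul_le_mul_of_nonneg_right h3 (by positivity)
      _ = _ := by ring
  have h5 : HasFDerivAt (fun π' => value M ν π' - inner ℝ (policyGradient M ν π) (π' - π)
      - value M ν π) (0 : PolicySpace S A →L[ℝ] ℝ) π := hO.hasFDerivAt one_lt_two
  rw [hasGradientAt_iff_hasFDerivAt]
  have h6 : HasFDerivAt (fun π' => inner ℝ (policyGradient M ν π) (π' - π))
      (InnerProductSpace.toDual ℝ _ (policyGradient M ν π)) π := by
    have := (InnerProductSpace.toDual ℝ _ (policyGradient M ν π)).hasFDerivAt.comp π
      ((hasFDerivAt_id π).sub_const π)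
    exact this
  have h7 := (h5.add h6).add_const (value M ν π)
  rw [zero_add] at h7
  refine h7.congr_of_eventuallyEq (Filter.Eventually.of_forall fun π' => ?_)
  simp only [Pi.add_apply]
  ring

theorem gradient_value (M : MDP S A) {ν : S → ℝ} (hν : ν ∈ stdSimplex ℝ S)
    {π : PolicySpace S A} (hπ : π ∈ policies S A) :
    gradient (value M ν) π = policyGradient M ν π := (hasGradientAt_value M hν hπ).gradient

/-- Product rule: the change of occupancy and the change of action values each contribute
`γ|A|/(1-γ)³`. One `√|A|` comes from Cauchy–Schwarz on a row, the other from the Frobenius norm. -/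
theorem norm_policyGradient_sub_le (M : MDP S A) {ν : S → ℝ} (hν : ν ∈ stdSimplex ℝ S)
    {π π' : PolicySpace S A} (hπ : π ∈ policies S A) (hπ' : π' ∈ policies S A) :
    ‖policyGradient M ν π' - policyGradient M ν π‖ ≤ LF M * ‖π' - π‖ := by
  have hγ := one_sub_gamma_pos M
  have hγ0 := M.γ_nonneg
  set c := √(Fintype.card A : ℝ) with hc
  have hc2 : c ^ 2 = Fintype.card A := Real.sq_sqrt (Nat.cast_nonneg _)
  set u : PolicySpace S A := WithLp.toLp 2 fun x =>
    -((occupancy M ν π' x.1 - occupancy M ν π x.1) * actionValue M π' x.1 x.2) with hu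
  set v : PolicySpace S A := WithLp.toLp 2 fun x =>
    -(occupancy M ν π x.1 * (actionValue M π' x.1 x.2 - actionValue M π x.1 x.2)) with hv
  have e : policyGradient M ν π' - policyGradient M ν π = u + v := by
    ext x
    simp only [policyGradient, hu, hv, PiLp.sub_apply, PiLp.add_apply]
    ring
  have h1 := norm_le_of_abs_le_mul (x := u)
    (u := fun s => occupancy M ν π' s - occupancy M ν π s) (c := 1 / (1 - M.γ)) (by positivity)
    (fun s a => by
      simp only [hu, abs_neg, abs_mul]
      exact mul_le_mul_of_nonneg_left (abs_actionValue_le M hπ' s a) (abs_nonneg _))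
  have h2 := norm_le_of_abs_le_mul (x := v) (u := occupancy M ν π)
    (c := M.γ * (c * ‖π' - π‖ / (1 - M.γ) / (1 - M.γ))) (by positivity)
    (fun s a => by
      simp only [hv, abs_neg, abs_mul]
      exact mul_le_mul_of_nonneg_left (abs_actionValue_sub_le M hπ hπ' s a) (abs_nonneg _))
  have h3 := sum_abs_occupancy_sub_le M hν hπ zero_le_one (sum_abs_le_one_of_mem_policies hπ')
    (gamma_mul_one_lt M)
  rw [mul_one, mul_comm, ← le_div_iff₀ hγ] at h3
  have h4 := sum_abs_occupancy_le M hν hπ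
  rw [e]
  refine (norm_add_le _ _).trans ((add_le_add
    (h1.trans (mul_le_mul_of_nonneg_left h3 (by positivity)))
    (h2.trans (mul_le_mul_of_nonneg_left h4 (by positivity)))).trans (le_of_eq ?_))
  rw [LF, ← hc, ← hc2]
  field_simp
  ring

theorem LF_nonneg (M : MDP S A) : 0 ≤ LF M := by
  have := one_sub_gamma_pos M
  have := M.γ_nonneg
  rw [LF]
  positivity

theorem isSmoothOver_value (M : MDP S A) {ν : S → ℝ} (hν : ν ∈ stdSimplex ℝ S)
    (hne : (policies S A).Nonempty) : IsSmoothOver (policies S A) (value M ν) (LF M) where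
  convex := convex_policies
  isCompact := isCompact_policies
  nonempty := hne
  hasGradientAt π hπ := by
    rw [gradient_value M hν hπ]
    exact hasGradientAt_value M hν hπ
  nonneg := LF_nonneg M
  norm_gradient_sub_le π hπ π' hπ' := by
    rw [gradient_value M hν hπ, gradient_value M hν hπ']
    exact norm_policyGradient_sub_le M hν hπ' hπ

theorem exists_greedy_policy [Nonempty A] (M : MDP S A) (π : PolicySpace S A) :
    ∃ π' ∈ policies S A, ∀ s, ∀ ρ ∈ policies S A,
      ∑ a, ρ (s, a) * actionValue M π s a ≤ ∑ a, π' (s, a) * actionValue M π s a := by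
  classical
  choose m hm using fun s => Finite.exists_max (actionValue M π s)
  refine ⟨WithLp.toLp 2 fun x => if x.2 = m x.1 then 1 else 0, fun s => ⟨fun a => ?_, ?_⟩,
    fun s ρ hρ => ?_⟩
  · dsimp only
    split_ifs <;> norm_num
  · simp
  · simp only [ite_mul, one_mul, zero_mul, Finset.sum_ite_eq', Finset.mem_univ, if_true]
    calc ∑ a, ρ (s, a) * actionValue M π s a
        ≤ ∑ a, ρ (s, a) * actionValue M π s (m s) := Finset.sum_le_sum fun a _ =>
          mul_le_mul_of_nonneg_left (hm s a) ((hρ s).1 a)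
      _ = actionValue M π s (m s) := by rw [← Finset.sum_mul, (hρ s).2, one_mul]

/-- Gradient domination under distribution mismatch. -/
theorem exists_value_sub_le_inner [Nonempty A] (M : MDP S A) {ν μ : S → ℝ}
    (hν : ∀ s, 0 ≤ ν s) (hμ : μ ∈ stdSimplex ℝ S) {πopt : PolicySpace S A}
    (hopt : πopt ∈ policies S A) {κ : ℝ} (hκ0 : 0 ≤ κ)
    (hκ : ∀ s, visitation M ν πopt s ≤ κ * μ s) {π : PolicySpace S A} (hπ : π ∈ policies S A) :
    ∃ π' ∈ policies S A, value M ν π - value M ν πopt ≤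
      κ / (1 - M.γ) * inner ℝ (gradient (value M μ) π) (π - π') := by
  have hγ := one_sub_gamma_pos M
  obtain ⟨π', hπ', hmax⟩ := exists_greedy_policy M π
  refine ⟨π', hπ', ?_⟩
  have h1 := value_sub_value M ν hπ zero_le_one (sum_abs_le_one_of_mem_policies hopt)
    (gamma_mul_one_lt M)
  have h2 : value M ν π - value M ν πopt = ∑ s, occupancy M ν πopt s *
      ∑ a, (πopt (s, a) - π (s, a)) * actionValue M π s a := by linarith
  rw [h2, gradient_value M hμ hπ, inner_policyGradient, ← Finset.sum_neg_distrib, Finset.mul_sum]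
  refine Finset.sum_le_sum fun s _ => ?_
  simp only [PiLp.sub_apply, sub_mul, Finset.sum_sub_distrib]
  -- The greedy advantage dominates that of `πopt` and is nonnegative. Its weight may therefore be
  -- raised from the occupancy of `πopt` to `κ/(1-γ)` times that of `π`, which is at least `μ`.
  have h3 := hmax s πopt hopt
  have h4 := hmax s π hπ
  have h5 := hκ s
  rw [visitation_eq, mul_comm, ← le_div_iff₀ hγ] at h5
  have h6 : occupancy M ν πopt s ≤ κ / (1 - M.γ) * occupancy M μ π s := by
    refine h5.trans ?_
    rw [mul_div_right_comm]
    exact mul_le_mul_of_nonneg_left (le_occupancy M hμ.1 hπ s) (div_nonneg hκ0 hγ.le)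
  have h7 := mul_le_mul_of_nonneg_left (sub_le_sub_right h3
    (∑ a, π (s, a) * actionValue M π s a)) (occupancy_nonneg M hν hopt s)
  have h8 := mul_le_mul_of_nonneg_right h6 (sub_nonneg.2 h4)
  linarith

theorem one_le_of_visitation_le (M : MDP S A) {ν μ : S → ℝ} (hν : ν ∈ stdSimplex ℝ S)
    (hμ : μ ∈ stdSimplex ℝ S) {π : PolicySpace S A} (hπ : π ∈ policies S A) {κ : ℝ}
    (hκ : ∀ s, visitation M ν π s ≤ κ * μ s) : 1 ≤ κ := by
  have := Finset.sum_le_sum fun s (_ : s ∈ Finset.univ) => hκ s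
  rwa [sum_visitation M hν hπ, ← Finset.mul_sum, hμ.2, mul_one] at this

/-- The suboptimality gap at a mirror step is controlled by its length. -/
theorem value_sub_le_of_isMirrorStep [Nonempty A] (M : MDP S A) {ν μ : S → ℝ}
    (hν : ∀ s, 0 ≤ ν s) (hμ : μ ∈ stdSimplex ℝ S) {πopt : PolicySpace S A}
    (hopt : πopt ∈ policies S A) {κ : ℝ} (hκ0 : 0 ≤ κ)
    (hκ : ∀ s, visitation M ν πopt s ≤ κ * μ s) {π πp : PolicySpace S A}
    (hπ : π ∈ policies S A) (hp : IsMirrorStep (policies S A) (value M μ) (LF M) π πp) :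
    value M ν πp - value M ν πopt ≤
      2 * (κ / (1 - M.γ)) * √(2 * Fintype.card S) * (LF M * ‖π - πp‖) := by
  have hγ := one_sub_gamma_pos M
  have hL := LF_nonneg M
  obtain ⟨π', hπ', h⟩ := exists_value_sub_le_inner M hν hμ hopt hκ0 hκ hp.1
  refine h.trans ?_
  have hs := isSmoothOver_value M hμ ⟨π, hπ⟩
  have h1 := hp.inner_nonneg convex_policies hπ'
  have h2 := hs.norm_gradient_sub_le _ hp.1 _ hπ
  set d := gradient (value M μ) πp - gradient (value M μ) π + LF M • (π - πp) with hd
  -- Optimality of the mirror step at `π` allows its optimality vector to be subtracted; what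
  -- remains has length at most `2L ‖π - πp‖`.
  have h3 : inner ℝ (gradient (value M μ) πp) (πp - π') ≤ inner ℝ d (πp - π') := by
    have e : d = gradient (value M μ) πp -
        (gradient (value M μ) π + LF M • (πp - π)) := by rw [hd]; module
    rw [e, inner_sub_left, ← neg_sub π' πp, inner_neg_right, inner_neg_right]
    linarith
  have h4 : ‖d‖ ≤ 2 * (LF M * ‖π - πp‖) := by
    refine (norm_add_le _ _).trans ?_
    rw [norm_smul, Real.norm_of_nonneg hL]
    rw [norm_sub_rev πp π] at h2
    linarith
  have h5 : ‖πp - π'‖ ≤ √(2 * Fintype.card S) :=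
    Real.le_sqrt_of_sq_le (norm_sub_sq_le_of_mem_policies hp.1 hπ')
  have h6 : inner ℝ d (πp - π') ≤ 2 * (LF M * ‖π - πp‖) * √(2 * Fintype.card S) :=
    (real_inner_le_norm _ _).trans (mul_le_mul h4 h5 (norm_nonneg _) (by positivity))
  have := mul_le_mul_of_nonneg_left (h3.trans h6) (div_nonneg hκ0 hγ.le)
  linarith

end PolicyGradient

/-! ### Continuity of the projection -/

section Projection

variable {E : Type*} [NormedAddCommGroup E] [InnerProductSpace ℝ E] [CompleteSpace E]

theorem exists_continuous_isProj {X : Set E} (hX : Convex ℝ X) (hc : IsCompact X)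
    (hne : X.Nonempty) : ∃ pr : E → E, Continuous pr ∧ ∀ x, IsProj X x (pr x) := by
  choose pr hpr using exists_isProj hc hne
  refine ⟨pr, ?_, hpr⟩
  have : LipschitzWith 1 pr := LipschitzWith.of_dist_le_mul fun x y => by
    rw [dist_eq_norm, dist_eq_norm, NNReal.coe_one, one_mul]
    exact (hpr x).norm_sub_le hX (hpr y)
  exact this.continuous

end Projection

/-! ### Conditioning on the current iterate -/

section Stochastic

theorem integrable_comp_of_continuousOn {E Ω : Type*} [TopologicalSpace E] [MeasurableSpace E]
    [BorelSpace E] [MeasurableSpace Ω] {P : Measure Ω} [IsFiniteMeasure P] {X : Set E}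
    (hX : IsCompact X) {f : E → ℝ} (hf : ContinuousOn f X) {u : Ω → E} (hu : Measurable u)
    (huX : ∀ ω, u ω ∈ X) : Integrable (fun ω => f (u ω)) P := by
  obtain ⟨C, hC⟩ := hX.exists_bound_of_continuousOn hf
  have hm : Measurable fun ω => X.domRestrict f ⟨u ω, huX ω⟩ :=
    (continuousOn_iff_continuous_domRestrict.1 hf).measurable.comp (hu.subtype_mk)
  exact Integrable.of_bound hm.aestronglyMeasurable C (Filter.Eventually.of_forall fun ω =>
    hC _ (huX ω))

/-- An upper bound for the mean of a function dominated by a quadratic in unbiased noise. -/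
theorem integral_le_of_le_quadratic {E Ξ : Type*} [NormedAddCommGroup E] [InnerProductSpace ℝ E]
    [CompleteSpace E] [MeasurableSpace Ξ] {law : Measure Ξ} [IsProbabilityMeasure law]
    {g : Ξ → E} {G b : E} {f : Ξ → ℝ} {q c σ : ℝ} (hc : 0 ≤ c) (hg : Integrable g law)
    (hmean : ∫ ζ, g ζ ∂law = G) (hsq : Integrable (fun ζ => ‖g ζ - G‖ ^ 2) law)
    (hvar : ∫ ζ, ‖g ζ - G‖ ^ 2 ∂law ≤ σ ^ 2) (hf : Integrable f law)
    (h : ∀ ζ, f ζ ≤ q + inner ℝ b (g ζ - G) + c * ‖g ζ - G‖ ^ 2) :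
    ∫ ζ, f ζ ∂law ≤ q + c * σ ^ 2 := by
  have hd : Integrable (fun ζ => g ζ - G) law := hg.sub (integrable_const _)
  have hi : Integrable (fun ζ => inner ℝ b (g ζ - G)) law := hd.const_inner b
  have h0 : ∫ ζ, inner ℝ b (g ζ - G) ∂law = 0 := by
    rw [integral_inner hd, integral_sub hg (integrable_const _), hmean]
    simp
  have h1 : Integrable (fun ζ => q + inner ℝ b (g ζ - G)) law := (integrable_const q).add hi
  calc ∫ ζ, f ζ ∂law ≤ ∫ ζ, (q + inner ℝ b (g ζ - G) + c * ‖g ζ - G‖ ^ 2) ∂law :=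
        integral_mono hf (h1.add (hsq.const_mul c)) h
    _ = q + c * ∫ ζ, ‖g ζ - G‖ ^ 2 ∂law := by
        rw [integral_add h1 (hsq.const_mul c), integral_add (integrable_const q) hi, h0,
          integral_const_mul]
        simp
    _ ≤ q + c * σ ^ 2 := by gcongr

/-- A recursion driven by independent inputs is a function of the past inputs. -/
theorem exists_measurable_of_recursion {E Ξ Ω : Type*} [MeasurableSpace E] [MeasurableSpace Ξ]
    {Φ : ℕ → E → Ξ → E} (hΦ : ∀ t, Measurable (Function.uncurry (Φ t))) {x₀ : E}
    {ξ : ℕ → Ω → Ξ} {u : ℕ → Ω → E} (h0 : ∀ ω, u 0 ω = x₀)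
    (hstep : ∀ t ω, u (t + 1) ω = Φ t (u t ω) (ξ t ω)) (t : ℕ) :
    ∃ G : (Finset.range t → Ξ) → E, Measurable G ∧ ∀ ω, u t ω = G fun i => ξ i ω := by
  induction t with
  | zero => exact ⟨fun _ => x₀, measurable_const, h0⟩
  | succ t ih =>
    obtain ⟨G, hG, hGu⟩ := ih
    refine ⟨fun y => Φ t (G fun i => y ⟨i, Finset.mem_range.2
      ((Finset.mem_range.1 i.2).trans t.lt_succ_self)⟩)
      (y ⟨t, Finset.mem_range.2 t.lt_succ_self⟩), ?_, fun ω => ?_⟩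
    · exact (hΦ t).comp (Measurable.prodMk
        (hG.comp (measurable_pi_lambda _ fun i => measurable_pi_apply _)) (measurable_pi_apply _))
    · rw [hstep, hGu]

/-- The iterate at time `t` is a function of the samples with index below `t`, hence independent of
sample `t`. -/
theorem indepFun_of_recursion {E Ξ Ω : Type*} [MeasurableSpace E] [MeasurableSpace Ξ]
    [MeasurableSpace Ω] {P : Measure Ω}
    {Φ : ℕ → E → Ξ → E} (hΦ : ∀ t, Measurable (Function.uncurry (Φ t))) {x₀ : E}
    {ξ : ℕ → Ω → Ξ} {u : ℕ → Ω → E} (h0 : ∀ ω, u 0 ω = x₀)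
    (hstep : ∀ t ω, u (t + 1) ω = Φ t (u t ω) (ξ t ω)) (hξ : ∀ t, Measurable (ξ t))
    (hind : iIndepFun ξ P) (t : ℕ) : Measurable (u t) ∧ IndepFun (u t) (ξ t) P := by
  obtain ⟨G, hG, hGu⟩ := exists_measurable_of_recursion hΦ h0 hstep t
  have e : u t = G ∘ fun ω (i : Finset.range t) => ξ i ω := funext hGu
  refine ⟨?_, ?_⟩
  · rw [e]
    exact hG.comp (measurable_pi_lambda _ fun i => hξ i)
  · have h := hind.indepFun_finset (Finset.range t) {t} (by simp) hξ
    have := h.comp hG (measurable_pi_apply (⟨t, Finset.mem_singleton_self t⟩ : ({t} : Finset ℕ)))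
    rw [e]
    exact this

variable {S A : Type*} [Fintype S] [Fintype A] {M : MDP S A} {μ : S → ℝ} {σ : ℝ} {η : ℕ → ℝ}
  {π₀ : PolicySpace S A} {Ξ : Type*} [MeasurableSpace Ξ] {law : Measure Ξ}
  {g : PolicySpace S A → Ξ → PolicySpace S A} {Ω : Type*} [MeasurableSpace Ω] {P : Measure Ω}
  {ξ : ℕ → Ω → Ξ} {π : ℕ → Ω → PolicySpace S A}

theorem IsPSPG.mem_policies (h : IsPSPG η π₀ law g P ξ π) (h0 : π₀ ∈ policies S A) (t : ℕ)
    (ω : Ω) : π t ω ∈ policies S A := by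
  cases t with
  | zero => rwa [h.init]
  | succ t => exact (h.step t ω).1

theorem IsPSPG.measurable_and_indepFun (h : IsPSPG η π₀ law g P ξ π) (h0 : π₀ ∈ policies S A)
    (hg : Measurable (Function.uncurry g)) (t : ℕ) :
    Measurable (π t) ∧ IndepFun (π t) (ξ t) P := by
  obtain ⟨pr, hpr, hproj⟩ := exists_continuous_isProj (convex_policies (S := S) (A := A))
    isCompact_policies ⟨π₀, h0⟩
  refine indepFun_of_recursion (Φ := fun t x ζ => pr (x - η t • g x ζ)) (fun t => ?_) h.init
    (fun t ω => ?_) h.measurable h.indep t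
  · exact hpr.measurable.comp (measurable_fst.sub (hg.const_smul (η t)))
  · exact (h.step t ω).unique convex_policies (hproj _)

/-- Transfer of a one-step estimate at a fixed policy to the iterates. -/
theorem IsPSPG.integral_step_le [IsProbabilityMeasure law] [IsProbabilityMeasure P]
    (h : IsPSPG η π₀ law g P ξ π) (h0 : π₀ ∈ policies S A) (ho : IsGradientOracle M μ σ law g)
    {t : ℕ} {ψ q : PolicySpace S A → ℝ} {c : ℝ} (hc : 0 ≤ c)
    (hψ : ContinuousOn ψ (policies S A)) (hq : ContinuousOn q (policies S A))
    (hstep : ∀ x ∈ policies S A, ∃ b, ∀ v w, IsProj (policies S A) (x - η t • v) w →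
      ψ w ≤ q x + inner ℝ b (v - gradient (value M μ) x)
        + c * ‖v - gradient (value M μ) x‖ ^ 2) :
    ∫ ω, ψ (π (t + 1) ω) ∂P ≤ ∫ ω, q (π t ω) ∂P + c * σ ^ 2 := by
  obtain ⟨pr, hpr, hproj⟩ := exists_continuous_isProj (convex_policies (S := S) (A := A))
    isCompact_policies ⟨π₀, h0⟩
  obtain ⟨hm, hind⟩ := h.measurable_and_indepFun h0 ho.measurable t
  have hmem := h.mem_policies h0
  set f : PolicySpace S A × Ξ → ℝ := fun p => ψ (pr (p.1 - η t • g p.1 p.2)) with hf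
  have hwm : Measurable fun p : PolicySpace S A × Ξ => pr (p.1 - η t • g p.1 p.2) :=
    hpr.measurable.comp (measurable_fst.sub (ho.measurable.const_smul (η t)))
  -- Independence turns the joint law into a product; Fubini then freezes the iterate while the
  -- fresh sample is averaged.
  have hmap : P.map (fun ω => (π t ω, ξ t ω)) = (P.map (π t)).prod law := by
    rw [← h.map_eq t]
    exact (indepFun_iff_map_prod_eq_prod_map_map hm.aemeasurable
      (h.measurable t).aemeasurable).1 hind
  have : IsProbabilityMeasure (P.map (π t)) := Measure.isProbabilityMeasure_map hm.aemeasurable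
  have hfi : Integrable f ((P.map (π t)).prod law) :=
    integrable_comp_of_continuousOn isCompact_policies hψ hwm fun p => (hproj _).1
  have hqi : Integrable (fun ω => q (π t ω)) P :=
    integrable_comp_of_continuousOn isCompact_policies hq hm (hmem t)
  have hfe : ∫ ω, ψ (π (t + 1) ω) ∂P = ∫ ω, (∫ ζ, f (π t ω, ζ) ∂law) ∂P := by
    have e : ∀ ω, ψ (π (t + 1) ω) = f (π t ω, ξ t ω) := fun ω => by
      rw [hf, (h.step t ω).unique convex_policies (hproj _)]
    have hpm : Measurable fun ω => (π t ω, ξ t ω) := hm.prodMk (h.measurable t)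
    calc ∫ ω, ψ (π (t + 1) ω) ∂P = ∫ ω, f (π t ω, ξ t ω) ∂P := integral_congr_ae
          (Filter.Eventually.of_forall e)
      _ = ∫ p, f p ∂(P.map fun ω => (π t ω, ξ t ω)) := by
          rw [integral_map hpm.aemeasurable]
          rw [hmap]
          exact hfi.aestronglyMeasurable
      _ = ∫ x, (∫ ζ, f (x, ζ) ∂law) ∂(P.map (π t)) := by rw [hmap, integral_prod f hfi]
      _ = _ := integral_map hm.aemeasurable
          hfi.integral_prod_left.aestronglyMeasurable
  have hint : Integrable (fun ω => ∫ ζ, f (π t ω, ζ) ∂law) P :=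
    hfi.integral_prod_left.comp_measurable hm
  rw [hfe]
  -- The vector `b` is used only at a frozen iterate and averages out there, so it need not depend
  -- measurably on the iterate.
  have hb : ∀ ω, ∫ ζ, f (π t ω, ζ) ∂law ≤ q (π t ω) + c * σ ^ 2 := fun ω => by
    have hx := hmem t ω
    obtain ⟨b, hb⟩ := hstep _ hx
    refine integral_le_of_le_quadratic hc (ho.integrable _ hx) (ho.unbiased _ hx)
      (ho.integrable_sq _ hx) (ho.variance_le _ hx) ?_ (b := b) fun ζ => hb _ _ (hproj _)
    exact integrable_comp_of_continuousOn isCompact_policies hψ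
      (hwm.comp measurable_prodMk_left) fun ζ => (hproj _).1
  refine (integral_mono hint (hqi.add (integrable_const _)) hb).trans (le_of_eq ?_)
  rw [integral_add' hqi (integrable_const _)]
  simp

theorem sq_integral_le_integral_sq {Ω : Type*} [MeasurableSpace Ω] {P : Measure Ω}
    [IsProbabilityMeasure P] {r : Ω → ℝ} (hr : Integrable r P)
    (hr2 : Integrable (fun ω => r ω ^ 2) P) : (∫ ω, r ω ∂P) ^ 2 ≤ ∫ ω, r ω ^ 2 ∂P := by
  set s := ∫ ω, r ω ∂P with hs
  have h0 : 0 ≤ ∫ ω, (r ω - s) ^ 2 ∂P := integral_nonneg fun ω => sq_nonneg _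
  have e : ∫ ω, (r ω - s) ^ 2 ∂P = ∫ ω, (r ω ^ 2 - 2 * s * r ω + s ^ 2) ∂P :=
    integral_congr_ae (Filter.Eventually.of_forall fun ω => by ring)
  have h1 : Integrable (fun ω => r ω ^ 2 - 2 * s * r ω) P := hr2.sub (hr.const_mul _)
  rw [e, integral_add h1 (integrable_const _),
    integral_sub hr2 (hr.const_mul _), integral_const_mul, ← hs] at h0
  simp at h0
  linarith

end Stochastic

/-! ### Deterministic recursions -/

section Recursions

/-- If every `t < T` failed, the summed drops would exceed `a 0 - a T`. The induction also carries
the strict inequality for `n ≥ 1`, since the case `n = 0` is an equality. -/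
theorem exists_lt_of_telescoping {a d : ℕ → ℝ} {k r : ℝ} {T : ℕ} (hT : 1 ≤ T)
    (h : ∀ t, a (t + 1) ≤ a t - k * d t + r) :
    ∃ t < T, k * d t ≤ (a 0 - a T) / T + r := by
  by_contra! hcon
  have hind : ∀ n ≤ T, a n + n * ((a 0 - a T) / T) ≤ a 0 ∧
      (1 ≤ n → a n + n * ((a 0 - a T) / T) < a 0) := by
    intro n
    induction n with
    | zero => intro _; simp
    | succ n ih =>
      intro hn
      have h1 := (ih (by omega)).1
      have h2 := hcon n (by omega)
      have h3 := h n
      push_cast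
      have : a (n + 1) + (n + 1) * ((a 0 - a T) / T) < a 0 := by linarith
      exact ⟨this.le, fun _ => this⟩
  have h1 := (hind T le_rfl).2 hT
  have hT0 : (T : ℝ) ≠ 0 := by positivity
  rw [mul_div_cancel₀ _ hT0] at h1
  linarith

/-- Suppose `e t > ε²/K²` throughout. Then `r` eats at most half of the drop, and `e t ≥ (a t)²/K²`
forces `a t ≤ K²/(k t)`. The remaining drops, each above `k ε²/K²`, must fit into the value of `a`
at half time; this contradicts the lower bound on `T`. -/
theorem exists_le_of_quadratic_recursion {a e : ℕ → ℝ} {k K ε r : ℝ} {T : ℕ} (hT : 1 ≤ T)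
    (hk : 0 < k) (hK : 0 < K) (hε : 0 < ε) (ha : ∀ t, 0 ≤ a t)
    (hae : ∀ t, a t ^ 2 ≤ K ^ 2 * e t) (h : ∀ t, a (t + 1) ≤ a t - 2 * k * e t + r)
    (hr : r ≤ k * (ε ^ 2 / K ^ 2)) (hTk : 2 * K ^ 2 ≤ T * k * ε) :
    ∃ t ≤ T, e t ≤ ε ^ 2 / K ^ 2 := by
  by_contra! hcon
  set θ := ε ^ 2 / K ^ 2 with hθ
  have hstep : ∀ t ≤ T, a (t + 1) ≤ a t - k * e t := fun t ht => by
    have := mul_lt_mul_of_pos_left (hcon t ht) hk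
    linarith [h t]
  have hdecay : ∀ t ≤ T + 1, a t * k * t ≤ K ^ 2 := by
    intro t
    induction t with
    | zero => intro _; simp; positivity
    | succ t ih =>
      intro ht
      have h1 := ih (by omega)
      have h2 := hstep t (by omega)
      set x := a t * k / K ^ 2 with hx
      have hx0 : 0 ≤ x := div_nonneg (mul_nonneg (ha t) hk.le) (sq_nonneg K)
      have hat : a t * k = K ^ 2 * x := by rw [hx]; field_simp
      have hxt : x * t ≤ 1 := by
        rw [hat] at h1
        have hK2 : 0 < K ^ 2 := by positivity
        nlinarith
      have h3 : a (t + 1) * k ≤ K ^ 2 * (x - x ^ 2) := by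
        have h4 := mul_le_mul_of_nonneg_right h2 hk.le
        have h5 : K ^ 2 * x ^ 2 ≤ k * e t * k := by
          have h6 := hae t
          have h7 : (K ^ 2 * x) ^ 2 ≤ K ^ 2 * e t * k ^ 2 := by
            rw [← hat, mul_pow]
            exact mul_le_mul_of_nonneg_right h6 (sq_nonneg k)
          have hK2 : 0 < K ^ 2 := by positivity
          refine le_of_mul_le_mul_left ?_ hK2
          linarith
        linarith
      -- Multiplied by `1 + x`, the left side is `(x - x³)(t + 1) ≤ x t + x ≤ 1 + x`.
      have h8 : (x - x ^ 2) * (t + 1) ≤ 1 := by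
        have h9 : (1 + x) * ((x - x ^ 2) * (t + 1)) ≤ (1 + x) * 1 := by
          have h10 : 0 ≤ x * x ^ 2 * (t + 1) := by positivity
          linarith
        exact le_of_mul_le_mul_left h9 (by linarith)
      push_cast
      calc a (t + 1) * k * (t + 1) ≤ K ^ 2 * (x - x ^ 2) * (t + 1) := by gcongr
        _ = K ^ 2 * ((x - x ^ 2) * (t + 1)) := by ring
        _ ≤ K ^ 2 * 1 := by gcongr
        _ = K ^ 2 := mul_one _
  have hsum : ∀ n m, m + n ≤ T + 1 → k * θ * n ≤ a m := by
    intro n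
    induction n with
    | zero => intro m _; simpa using ha m
    | succ n ih =>
      intro m hm
      have h1 := ih (m + 1) (by omega)
      have h2 := hstep m (by omega)
      have h3 := mul_lt_mul_of_pos_left (hcon m (by omega)) hk
      push_cast
      linarith
  -- `m = ⌈T/2⌉` steps of decay, then `n = ⌊T/2⌋ + 1` steps of constant drop. The extra step, from
  -- the `T + 1` indices `t ≤ T`, makes the contradiction strict.
  obtain ⟨m, n, hmn, hm, hn⟩ : ∃ m n : ℕ, m + n = T + 1 ∧ T ≤ 2 * m ∧ T + 1 ≤ 2 * n :=
    ⟨T / 2 + T % 2, T + 1 - (T / 2 + T % 2), by omega, by omega, by omega⟩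
  have h1 := hsum n m hmn.le
  have h2 := hdecay m (by omega)
  have hm' : (T : ℝ) ≤ 2 * m := by exact_mod_cast hm
  have hn' : (T : ℝ) + 1 ≤ 2 * n := by exact_mod_cast hn
  have hT' : (1 : ℝ) ≤ T := by exact_mod_cast hT
  have hθ0 : 0 < θ := by positivity
  have h3 : k * θ * n * k * m ≤ K ^ 2 := by
    refine le_trans ?_ h2
    gcongr
  have h4 : k * θ * ((T + 1) / 2) * k * (T / 2) ≤ k * θ * n * k * m := by
    gcongr <;> linarith
  have h5 : k * θ * (T / 2) * k * (T / 2) < k * θ * ((T + 1) / 2) * k * (T / 2) := by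
    gcongr
    linarith
  have h6 : (2 * K ^ 2) ^ 2 ≤ (T * k * ε) ^ 2 := by gcongr
  have h7 : k * θ * (T / 2) * k * (T / 2) = (T * k * ε) ^ 2 / (4 * K ^ 2) := by
    rw [hθ]; field_simp; ring
  have h8 : (2 * K ^ 2) ^ 2 / (4 * K ^ 2) = K ^ 2 := by field_simp; ring
  have h9 := div_le_div_of_nonneg_right h6 (by positivity : 0 ≤ 4 * K ^ 2)
  linarith

end Recursions

/-! ### Complexity bounds for P-SPG with constant step sizes -/

section Convergence

variable {S A : Type*} [Fintype S] [Fintype A]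

theorem valueStar_le (M : MDP S A) {ν : S → ℝ} (hν : ν ∈ stdSimplex ℝ S) {π : PolicySpace S A}
    (hπ : π ∈ policies S A) : valueStar M ν ≤ value M ν π := by
  have hs := isSmoothOver_value M hν ⟨π, hπ⟩
  exact csInf_le (hs.isCompact.image_of_continuousOn hs.continuousOn).bddBelow ⟨π, hπ, rfl⟩

theorem valueStar_eq (M : MDP S A) {ν : S → ℝ} {π : PolicySpace S A}
    (hπ : π ∈ policies S A) (hmin : IsMinOn (value M ν) (policies S A) π) :
    valueStar M ν = value M ν π := by
  have : IsLeast (value M ν '' policies S A) (value M ν π) :=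
    ⟨⟨π, hπ, rfl⟩, by rintro _ ⟨y, hy, rfl⟩; exact hmin hy⟩
  exact this.csInf_eq

theorem nonempty_state_of_mem_stdSimplex {μ : S → ℝ} (hμ : μ ∈ stdSimplex ℝ S) : Nonempty S := by
  by_contra h
  rw [not_nonempty_iff] at h
  have := hμ.2
  simp at this

theorem nonempty_action_of_mem_policies {π : PolicySpace S A} (hπ : π ∈ policies S A) (s : S) :
    Nonempty A := by
  by_contra h
  rw [not_nonempty_iff] at h
  have := (hπ s).2
  simp at this

theorem isStepSize_const {M : MDP S A} {u : ℝ} (hu : 0 < u) (hLu : 2 * LF M ≤ u) :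
    IsStepSize M fun _ => 1 / u :=
  ⟨fun _ => one_div_pos.2 hu, antitone_const, fun _ => by
    rw [mul_one_div]; exact div_le_one_of_le₀ hLu hu.le⟩

theorem LF_le (M : MDP S A) : LF M ≤ 2 * (Fintype.card A / (1 - M.γ) ^ 3) := by
  have := one_sub_gamma_pos M
  rw [LF, ← mul_div_assoc]
  gcongr
  nlinarith [M.γ_lt_one]

/-- In the inverse step size, `2L` secures `2Lη ≤ 1` and the second term pushes the noise `2Lη²σ²`
below `ηε²/6`. The bound on `T` does the same for the telescoped gap, which is at most `2(V_μ(π₀) -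
V_μ^*)`; together they give `(η/3) ε²`. -/
theorem IsPSPG.exists_integral_bfbe_le {M : MDP S A} {μ : S → ℝ} (hμ : μ ∈ stdSimplex ℝ S)
    {π₀ : PolicySpace S A} (h0 : π₀ ∈ policies S A) {σ ε : ℝ} (hε : 0 < ε) (hL : 0 < LF M)
    {Ξ : Type*} [MeasurableSpace Ξ] {law : Measure Ξ} [IsProbabilityMeasure law]
    {g : PolicySpace S A → Ξ → PolicySpace S A} (ho : IsGradientOracle M μ σ law g)
    {Ω : Type*} [MeasurableSpace Ω] {P : Measure Ω} [IsProbabilityMeasure P]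
    {ξ : ℕ → Ω → Ξ} {π : ℕ → Ω → PolicySpace S A}
    (h : IsPSPG (fun _ => 1 / (2 * LF M + 12 * LF M * σ ^ 2 / ε ^ 2)) π₀ law g P ξ π)
    {T : ℕ} (hT : 1 ≤ T)
    (hTC : 12 * (value M μ π₀ - valueStar M μ) *
      ((2 * LF M + 12 * LF M * σ ^ 2 / ε ^ 2) / ε ^ 2) ≤ T) :
    ∃ t < T, ∫ ω, bfbe (policies S A) (value M μ) (3 * LF M) (π t ω) ∂P ≤ ε ^ 2 := by
  set L := LF M with hLdef
  set F := value M μ with hF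
  set u := 2 * L + 12 * L * σ ^ 2 / ε ^ 2 with hu
  have hs : IsSmoothOver (policies S A) F L := isSmoothOver_value M hμ ⟨π₀, h0⟩
  have hu0 : 0 < u := by positivity
  have hηL : 2 * L * (1 / u) ≤ 1 := by
    rw [mul_one_div]
    refine div_le_one_of_le₀ ?_ hu0.le
    have : 0 ≤ 12 * L * σ ^ 2 / ε ^ 2 := by positivity
    linarith
  set η : ℝ := 1 / u with hη
  have hη0 : 0 < η := one_div_pos.2 hu0
  set ψ : PolicySpace S A → ℝ := fun x => envelope (policies S A) F L x + 2 * L * η * F x with hψ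
  set D : PolicySpace S A → ℝ := bfbe (policies S A) F (3 * L) with hD
  have hψc : ContinuousOn ψ (policies S A) :=
    hs.continuous_envelope.continuousOn.add (hs.continuousOn.const_mul _)
  have hDc : ContinuousOn D (policies S A) := hs.continuousOn_bfbe _
  have hint : ∀ {f : PolicySpace S A → ℝ} (_ : ContinuousOn f (policies S A)) (t : ℕ),
      Integrable (fun ω => f (π t ω)) P := fun hf t =>
    integrable_comp_of_continuousOn isCompact_policies hf
      (h.measurable_and_indepFun h0 ho.measurable t).1 (h.mem_policies h0 t)
  have hrec : ∀ t, ∫ ω, ψ (π (t + 1) ω) ∂P ≤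
      ∫ ω, ψ (π t ω) ∂P - η / 3 * ∫ ω, D (π t ω) ∂P + 2 * L * η ^ 2 * σ ^ 2 := fun t => by
    have := h.integral_step_le h0 ho (t := t) (ψ := ψ) (q := fun x => ψ x - η / 3 * D x)
      (c := 2 * L * η ^ 2) (by positivity) hψc (hψc.sub (hDc.const_mul _)) (fun x hx => by
        obtain ⟨z, hz⟩ := hs.exists_isProx x
        exact ⟨_, fun v w hw => hs.envelope_add_step_le hη0.le hηL hx hz hw⟩)
    rwa [integral_sub (hint hψc t) ((hint hDc t).const_mul _), integral_const_mul] at this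
  obtain ⟨t, ht, hle⟩ := exists_lt_of_telescoping
    (a := fun t => ∫ ω, ψ (π t ω) ∂P) (d := fun t => ∫ ω, D (π t ω) ∂P) hT hrec
  refine ⟨t, ht, ?_⟩
  have hT0 : (0 : ℝ) < T := by exact_mod_cast hT
  have ha0 : ∫ ω, ψ (π 0 ω) ∂P = ψ π₀ := by simp [h.init]
  have haT : (1 + 2 * L * η) * valueStar M μ ≤ ∫ ω, ψ (π T ω) ∂P := by
    have hc : ∫ _ω : Ω, (1 + 2 * L * η) * valueStar M μ ∂P = (1 + 2 * L * η) * valueStar M μ := by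
      simp
    rw [← hc]
    refine integral_mono (integrable_const _) (hint hψc T) fun ω => ?_
    have h1 := hs.le_envelope (fun y hy => valueStar_le M hμ hy) (π T ω)
    have h2 := valueStar_le M hμ (h.mem_policies h0 T ω)
    have h3 := mul_le_mul_of_nonneg_left h2 (by positivity : 0 ≤ 2 * L * η)
    simp only [hψ]
    linarith
  have hΔ : 0 ≤ F π₀ - valueStar M μ := sub_nonneg.2 (valueStar_le M hμ h0)
  have hgap : ∫ ω, ψ (π 0 ω) ∂P - ∫ ω, ψ (π T ω) ∂P ≤ 2 * (F π₀ - valueStar M μ) := by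
    rw [ha0]
    have h1 := hs.envelope_le_self h0
    have h2 := mul_le_mul_of_nonneg_right hηL hΔ
    simp only [hψ]
    linarith
  have h1 : (∫ ω, ψ (π 0 ω) ∂P - ∫ ω, ψ (π T ω) ∂P) / T ≤ η * (ε ^ 2 / 6) := by
    rw [div_le_iff₀ hT0]
    refine hgap.trans ?_
    have h2 := mul_le_mul_of_nonneg_left hTC (by positivity : 0 ≤ η * (ε ^ 2 / 6))
    refine le_trans (le_of_eq ?_) h2
    rw [hη]
    field_simp
    ring
  have h2 : 2 * L * η ^ 2 * σ ^ 2 ≤ η * (ε ^ 2 / 6) := by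
    have h3 : 12 * L * σ ^ 2 / ε ^ 2 * η ≤ 1 := by
      rw [hη, mul_one_div]
      exact div_le_one_of_le₀ (by rw [hu]; linarith) hu0.le
    have h4 := mul_le_mul_of_nonneg_left h3 (by positivity : 0 ≤ η * (ε ^ 2 / 6))
    refine le_trans (le_of_eq ?_) (h4.trans (mul_one _).le)
    field_simp
    ring
  have h3 : η / 3 * ∫ ω, D (π t ω) ∂P ≤ η / 3 * ε ^ 2 := by linarith
  exact le_of_mul_le_mul_left h3 (by positivity)

theorem IsPSPG.exists_integral_value_sub_le {M : MDP S A} {μ : S → ℝ} (hμ : μ ∈ stdSimplex ℝ S)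
    {π₀ : PolicySpace S A} (h0 : π₀ ∈ policies S A) {σ ε : ℝ} (hε : 0 < ε) (hL : 0 < LF M)
    {πopt : PolicySpace S A} (hopt : πopt ∈ policies S A)
    (hoptp : IsMinOn (value M M.p) (policies S A) πopt)
    (hoptμ : IsMinOn (value M μ) (policies S A) πopt) {κ : ℝ}
    (hκp : ∀ s, visitation M M.p πopt s ≤ κ * μ s)
    (hκμ : ∀ s, visitation M μ πopt s ≤ κ * μ s) {K : ℝ}
    (hK : K = 3 * (κ / (1 - M.γ)) * √(2 * Fintype.card S))
    {Ξ : Type*} [MeasurableSpace Ξ] {law : Measure Ξ} [IsProbabilityMeasure law]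
    {g : PolicySpace S A → Ξ → PolicySpace S A} (ho : IsGradientOracle M μ σ law g)
    {Ω : Type*} [MeasurableSpace Ω] {P : Measure Ω} [IsProbabilityMeasure P]
    {ξ : ℕ → Ω → Ξ} {π : ℕ → Ω → PolicySpace S A}
    (h : IsPSPG (fun _ => 1 / (2 * LF M + 18 * K ^ 2 * LF M * σ ^ 2 / ε ^ 2)) π₀ law g P ξ π)
    {πplus : ℕ → Ω → PolicySpace S A}
    (hplus : ∀ t ω, IsMirrorStep (policies S A) (value M μ) (LF M) (π t ω) (πplus t ω))
    {T : ℕ} (hT : 1 ≤ T)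
    (hTC : 36 * K ^ 2 * (2 * LF M + 18 * K ^ 2 * LF M * σ ^ 2 / ε ^ 2) / ε ≤ T) :
    ∃ t ≤ T, Integrable (fun ω => value M M.p (πplus t ω) - valueStar M M.p) P ∧
      ∫ ω, (value M M.p (πplus t ω) - valueStar M M.p) ∂P ≤ ε := by
  have hγ := one_sub_gamma_pos M
  have : Nonempty S := nonempty_state_of_mem_stdSimplex hμ
  have : Nonempty A := nonempty_action_of_mem_policies h0 (Classical.arbitrary S)
  have hκ1 : 1 ≤ κ := one_le_of_visitation_le M hμ hμ hopt hκμ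
  have hκ0 : 0 ≤ κ := zero_le_one.trans hκ1
  set L := LF M with hLdef
  set F := value M μ with hF
  set R := √(2 * (Fintype.card S : ℝ)) with hR
  have hR0 : 0 < R := by
    have : (0 : ℝ) < Fintype.card S := by exact_mod_cast Fintype.card_pos
    positivity
  set G := κ / (1 - M.γ) with hG
  have hG1 : 1 ≤ G := by
    rw [hG, le_div_iff₀ hγ]
    linarith [M.γ_nonneg]
  have hK0 : 0 < K := by rw [hK]; positivity
  -- The second term makes the noise `Lη²σ²` at most `(η/18) ε²/K²`, half of the guaranteed drop
  -- while `E r² > ε²/K²`.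
  set u := 2 * L + 18 * K ^ 2 * L * σ ^ 2 / ε ^ 2 with hu
  have hs : IsSmoothOver (policies S A) F L := isSmoothOver_value M hμ ⟨π₀, h0⟩
  have hu0 : 0 < u := by positivity
  have hηL : 2 * L * (1 / u) ≤ 1 := by
    rw [mul_one_div]
    refine div_le_one_of_le₀ ?_ hu0.le
    have : 0 ≤ 18 * K ^ 2 * L * σ ^ 2 / ε ^ 2 := by positivity
    linarith
  set η : ℝ := 1 / u with hη
  have hη0 : 0 < η := one_div_pos.2 hu0
  obtain ⟨pr, hpr, hproj⟩ := exists_continuous_isProj (convex_policies (S := S) (A := A))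
    isCompact_policies ⟨π₀, h0⟩
  -- For `L > 0` the mirror step is unique and equals this continuous map on the policies, which
  -- makes `πplus` measurable.
  set plus : PolicySpace S A → PolicySpace S A := fun x => pr (x - L⁻¹ • gradient F x) with hplusdef
  have hplus_eq : ∀ {x z}, IsMirrorStep (policies S A) F L x z → z = plus x := fun hz =>
    (hz.isProj convex_policies hL).unique convex_policies (hproj _)
  have hplus_mem : ∀ x, plus x ∈ policies S A := fun x => (hproj _).1
  have hplus_cont : ContinuousOn plus (policies S A) :=
    hpr.comp_continuousOn (continuousOn_id.sub
      ((continuous_const_smul L⁻¹).comp_continuousOn hs.continuousOn_gradient))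
  set r : PolicySpace S A → ℝ := fun x => L * ‖x - plus x‖ with hr
  have hrc : ContinuousOn r (policies S A) :=
    ((continuousOn_id.sub hplus_cont).norm).const_mul _
  have hr2c : ContinuousOn (fun x => r x ^ 2) (policies S A) := hrc.pow 2
  set ψ : PolicySpace S A → ℝ := fun x => envelope (policies S A) F L x - valueStar M μ with hψ
  have hψc : ContinuousOn ψ (policies S A) :=
    hs.continuous_envelope.continuousOn.sub continuousOn_const
  have hmem := h.mem_policies h0
  have hint : ∀ {f : PolicySpace S A → ℝ} (_ : ContinuousOn f (policies S A)) (t : ℕ),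
      Integrable (fun ω => f (π t ω)) P := fun hf t =>
    integrable_comp_of_continuousOn isCompact_policies hf
      (h.measurable_and_indepFun h0 ho.measurable t).1 (hmem t)
  have hmirror : ∀ x ∈ policies S A, IsMirrorStep (policies S A) F L x (plus x) := by
    intro x hx
    obtain ⟨z, hz, hmin⟩ := hs.isCompact.exists_isMinOn hs.nonempty
      (f := fun y => inner ℝ (gradient F x) y + L * bregman euclDGF y x) (by
        simp only [bregman_euclDGF]; fun_prop)
    have hz' : IsMirrorStep (policies S A) F L x z := ⟨hz, hmin⟩
    rwa [← hplus_eq hz']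
  have hψ_nonneg : ∀ x, 0 ≤ ψ x := fun x =>
    sub_nonneg.2 (hs.le_envelope (fun y hy => valueStar_le M hμ hy) x)
  -- Test the envelope at `x⁺`: gradient domination gives `2GRr`, and `L ‖x⁺ - x‖² ≤ Rr ≤ GRr` the
  -- third share of `K = 3GR`.
  have hψ_le : ∀ x ∈ policies S A, ψ x ≤ K * r x := fun x hx => by
    have h1 := hs.envelope_le x (hplus_mem x)
    have h2 := value_sub_le_of_isMirrorStep M hμ.1 hμ hopt hκ0 hκμ hx (hmirror x hx)
    have h3 : ‖x - plus x‖ ≤ R :=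
      Real.le_sqrt_of_sq_le (norm_sub_sq_le_of_mem_policies hx (hplus_mem x))
    have hr0 : 0 ≤ r x := by positivity
    have h4 : L * ‖plus x - x‖ ^ 2 ≤ R * r x := by
      rw [norm_sub_rev]
      calc L * ‖x - plus x‖ ^ 2 = ‖x - plus x‖ * r x := by rw [hr]; ring
        _ ≤ R * r x := by gcongr
    have h5 : R * r x ≤ G * (R * r x) := le_mul_of_one_le_left (by positivity) hG1
    have h6 : valueStar M μ = F πopt := valueStar_eq M hopt hoptμ
    have h7 : F (plus x) - F πopt ≤ 2 * G * R * r x := h2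
    simp only [hψ]
    rw [hK, h6]
    linarith
  have hrec : ∀ t, ∫ ω, ψ (π (t + 1) ω) ∂P ≤
      ∫ ω, ψ (π t ω) ∂P - 2 * (η / 18) * ∫ ω, r (π t ω) ^ 2 ∂P + L * η ^ 2 * σ ^ 2 := fun t => by
    have := h.integral_step_le h0 ho (t := t) (ψ := ψ)
      (q := fun x => ψ x - 2 * (η / 18) * r x ^ 2)
      (c := L * η ^ 2) (by positivity) hψc (hψc.sub (hr2c.const_mul _)) (fun x hx => by
        obtain ⟨z, hz⟩ := hs.exists_isProx x
        refine ⟨(-(2 * L * η)) • ((1 - 2 * L * η) • (x - z)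
          - η • (gradient F x - gradient F z)), fun v w hw => ?_⟩
        have h1 := hs.envelope_step_le hη0.le hηL hx hz hw
        have h2 := hs.norm_sub_le_of_isMirrorStep hL hx hz (hmirror x hx)
        -- The envelope drop `ηL² ‖x - z‖²` is thus at least `η r²/9`, written as `2 (η/18) r²`.
        have h3 : r x ^ 2 ≤ 9 * L ^ 2 * ‖x - z‖ ^ 2 := by
          calc r x ^ 2 = L ^ 2 * ‖x - plus x‖ ^ 2 := by rw [hr]; ring
            _ ≤ L ^ 2 * (3 * ‖x - z‖) ^ 2 := by gcongr
            _ = _ := by ring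
        have h4 := mul_le_mul_of_nonneg_left h3 hη0.le
        have h5 : ψ w = envelope (policies S A) F L w - valueStar M μ := rfl
        have h6 : ψ x = envelope (policies S A) F L x - valueStar M μ := rfl
        rw [h5]
        refine (sub_le_sub_right h1 _).trans ?_
        simp only [h6]
        linarith)
    rwa [integral_sub (hint hψc t) ((hint hr2c t).const_mul _), integral_const_mul] at this
  have hψ_sq : ∀ t, (∫ ω, ψ (π t ω) ∂P) ^ 2 ≤ K ^ 2 * ∫ ω, r (π t ω) ^ 2 ∂P := fun t => by
    have h1 : ∫ ω, ψ (π t ω) ∂P ≤ K * ∫ ω, r (π t ω) ∂P := by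
      rw [← integral_const_mul]
      exact integral_mono (hint hψc t) ((hint hrc t).const_mul _) fun ω => hψ_le _ (hmem t ω)
    have h2 := sq_integral_le_integral_sq (hint hrc t) (hint hr2c t)
    have h3 : 0 ≤ ∫ ω, ψ (π t ω) ∂P := integral_nonneg fun ω => hψ_nonneg _
    calc (∫ ω, ψ (π t ω) ∂P) ^ 2 ≤ (K * ∫ ω, r (π t ω) ∂P) ^ 2 := by gcongr
      _ = K ^ 2 * (∫ ω, r (π t ω) ∂P) ^ 2 := by ring
      _ ≤ _ := by gcongr
  have hnoise : L * η ^ 2 * σ ^ 2 ≤ η / 18 * (ε ^ 2 / K ^ 2) := by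
    have h3 : 18 * K ^ 2 * L * σ ^ 2 / ε ^ 2 * η ≤ 1 := by
      rw [hη, mul_one_div]
      exact div_le_one_of_le₀ (by rw [hu]; linarith) hu0.le
    have h4 := mul_le_mul_of_nonneg_left h3 (by positivity : 0 ≤ η / 18 * (ε ^ 2 / K ^ 2))
    refine le_trans (le_of_eq ?_) (h4.trans (mul_one _).le)
    field_simp
  have hTη : 2 * K ^ 2 ≤ T * (η / 18) * ε := by
    have h1 := mul_le_mul_of_nonneg_right hTC (by positivity : 0 ≤ η / 18 * ε)
    refine le_trans (le_of_eq ?_) (h1.trans (le_of_eq (by ring)))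
    rw [hη]
    field_simp
    ring
  obtain ⟨t, ht, hle⟩ := exists_le_of_quadratic_recursion
    (a := fun t => ∫ ω, ψ (π t ω) ∂P) (e := fun t => ∫ ω, r (π t ω) ^ 2 ∂P) hT (by positivity) hK0 hε
    (fun t => integral_nonneg fun ω => hψ_nonneg (π t ω)) hψ_sq hrec hnoise hTη
  have hpm : Measurable (πplus t) := by
    have e : πplus t = fun ω => (policies S A).domRestrict plus ⟨π t ω, hmem t ω⟩ :=
      funext fun ω => hplus_eq (hplus t ω)
    rw [e]
    exact (continuousOn_iff_continuous_domRestrict.1 hplus_cont).measurable.comp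
      (h.measurable_and_indepFun h0 ho.measurable t).1.subtype_mk
  have hgi : Integrable (fun ω => value M M.p (πplus t ω) - valueStar M M.p) P :=
    (integrable_comp_of_continuousOn isCompact_policies
      (isSmoothOver_value M M.p_mem ⟨π₀, h0⟩).continuousOn hpm fun ω => (hplus t ω).1).sub
      (integrable_const _)
  refine ⟨t, ht, hgi, ?_⟩
  have h1 : ∫ ω, r (π t ω) ∂P ≤ ε / K := by
    have h2 := (sq_integral_le_integral_sq (hint hrc t) (hint hr2c t)).trans hle
    rw [← div_pow] at h2
    exact le_of_sq_le_sq h2 (by positivity)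
  calc ∫ ω, (value M M.p (πplus t ω) - valueStar M M.p) ∂P ≤ ∫ ω, K * r (π t ω) ∂P := by
        refine integral_mono hgi ((hint hrc t).const_mul _) fun ω => ?_
        have h2 := value_sub_le_of_isMirrorStep M M.p_mem.1 hμ hopt hκ0 hκp (hmem t ω) (hplus t ω)
        rw [hplus_eq (hplus t ω)] at h2
        have h3 : value M M.p (plus (π t ω)) - value M M.p πopt ≤ 2 * G * R * r (π t ω) := h2
        have h4 : 0 ≤ G * R * r (π t ω) := by positivity
        simp only [valueStar_eq M hopt hoptp, hplus_eq (hplus t ω)]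
        rw [hK]
        linarith
    _ = K * ∫ ω, r (π t ω) ∂P := integral_const_mul _ _
    _ ≤ K * (ε / K) := by gcongr
    _ = ε := by field_simp

theorem bfbe_rate_le (M : MDP S A) {σ ε : ℝ} (hε : 0 < ε) :
    12 * ((2 * LF M + 12 * LF M * σ ^ 2 / ε ^ 2) / ε ^ 2) ≤ 419904 * stationarityRate M σ ε := by
  have hγ := one_sub_gamma_pos M
  have e : stationarityRate M σ ε =
      Fintype.card A / (1 - M.γ) ^ 3 * (1 / ε ^ 2 + σ ^ 2 / ε ^ 4) := by
    rw [stationarityRate]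
    field_simp
  rw [e]
  calc 12 * ((2 * LF M + 12 * LF M * σ ^ 2 / ε ^ 2) / ε ^ 2)
      = LF M * (24 * (1 / ε ^ 2) + 144 * (σ ^ 2 / ε ^ 4)) := by field_simp; ring
    _ ≤ 2 * (Fintype.card A / (1 - M.γ) ^ 3) *
        (209952 * (1 / ε ^ 2) + 209952 * (σ ^ 2 / ε ^ 4)) := by
        gcongr
        · exact LF_le M
        · norm_num
        · norm_num
    _ = _ := by ring

/-- With `K² = 18 κ²|S|/(1-γ)²`, the noise term has constant `2 · 648 · 18² = 419904`, which becomes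
`C`; the noiseless term needs only 2592. -/
theorem value_rate_le [Nonempty A] (M : MDP S A) {κ σ ε K : ℝ} (hε : 0 < ε)
    (hK : K = 3 * (κ / (1 - M.γ)) * √(2 * Fintype.card S)) :
    36 * K ^ 2 * (2 * LF M + 18 * K ^ 2 * LF M * σ ^ 2 / ε ^ 2) / ε ≤
      419904 * globalRate M κ σ ε := by
  have hγ := one_sub_gamma_pos M
  have hK2 : K ^ 2 = 18 * (κ ^ 2 * Fintype.card S / (1 - M.γ) ^ 2) := by
    rw [hK, mul_pow, Real.sq_sqrt (by positivity)]
    field_simp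
    ring
  have hA : (1 : ℝ) ≤ Fintype.card A := by exact_mod_cast Fintype.card_pos
  set N : ℝ := (Fintype.card S : ℝ) with hN
  set B : ℝ := (Fintype.card A : ℝ) with hB
  have h1 : 36 * K ^ 2 * (2 * LF M + 18 * K ^ 2 * LF M * σ ^ 2 / ε ^ 2) / ε =
      LF M * (72 * K ^ 2 / ε + 648 * (K ^ 2) ^ 2 * σ ^ 2 / ε ^ 3) := by
    field_simp
    ring
  rw [h1]
  calc LF M * (72 * K ^ 2 / ε + 648 * (K ^ 2) ^ 2 * σ ^ 2 / ε ^ 3)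
      ≤ 2 * (B / (1 - M.γ) ^ 3) * (72 * K ^ 2 / ε + 648 * (K ^ 2) ^ 2 * σ ^ 2 / ε ^ 3) :=
        mul_le_mul_of_nonneg_right (LF_le M) (by positivity)
    _ = 2592 * (κ ^ 2 * (B * N) / ((1 - M.γ) ^ 5 * ε))
        + 419904 * (σ ^ 2 * κ ^ 4 * (B * N ^ 2) / ((1 - M.γ) ^ 7 * ε ^ 3)) := by
        rw [hK2]
        field_simp
        ring
    _ ≤ 419904 * (κ ^ 2 * (B * N) / ((1 - M.γ) ^ 5 * ε))
        + 419904 * (σ ^ 2 * κ ^ 4 * (B ^ 2 * N ^ 2) / ((1 - M.γ) ^ 7 * ε ^ 3)) := by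
        gcongr
        · norm_num
        · nlinarith
    _ = _ := by rw [globalRate]; ring

theorem globalRate_pos [Nonempty S] [Nonempty A] (M : MDP S A) {κ σ ε : ℝ} (hε : 0 < ε)
    (hκ : 0 < κ) : 0 < globalRate M κ σ ε := by
  have hγ := one_sub_gamma_pos M
  have hA : (0 : ℝ) < Fintype.card A := by exact_mod_cast Fintype.card_pos
  have hS : (0 : ℝ) < Fintype.card S := by exact_mod_cast Fintype.card_pos
  rw [globalRate]
  positivity

end Convergence

/-! ### Assembly of both claims -/

theorem corollary2 :
    ∃ C : ℝ, 0 < C ∧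
      ∀ (S A : Type*) [Fintype S] [Fintype A] (M : MDP S A)
        (μ : S → ℝ) (_ : μ ∈ stdSimplex ℝ S)
        (π₀ : PolicySpace S A) (_ : π₀ ∈ policies S A)
        (σ : ℝ) (_ : 0 ≤ σ) (ε : ℝ) (_ : 0 < ε),
        -- (i) stationarity
        (∃ η : ℕ → ℝ, IsStepSize M η ∧
          ∀ (Ξ : Type*) [MeasurableSpace Ξ] (law : Measure Ξ) [IsProbabilityMeasure law]
            (g : PolicySpace S A → Ξ → PolicySpace S A) (_ : IsGradientOracle M μ σ law g)
            (Ω : Type*) [MeasurableSpace Ω] (P : Measure Ω) [IsProbabilityMeasure P]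
            (ξ : ℕ → Ω → Ξ) (π : ℕ → Ω → PolicySpace S A) (_ : IsPSPG η π₀ law g P ξ π)
            (T : ℕ) (_ : 1 ≤ T)
            (_ : C * (value M μ π₀ - valueStar M μ) * stationarityRate M σ ε ≤ T),
            ∃ t < T,
              Integrable (fun ω => bfbe (policies S A) (value M μ) (3 * LF M) (π t ω)) P ∧
              ∫ ω, bfbe (policies S A) (value M μ) (3 * LF M) (π t ω) ∂P ≤ ε ^ 2) ∧
        -- (ii) global convergence in the function value
        (∀ (πopt : PolicySpace S A) (_ : πopt ∈ policies S A)
          (_ : IsMinOn (value M M.p) (policies S A) πopt)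
          (_ : IsMinOn (value M μ) (policies S A) πopt)
          (κ : ℝ) (_ : ∀ s, visitation M M.p πopt s ≤ κ * μ s)
          (_ : ∀ s, visitation M μ πopt s ≤ κ * μ s),
          ∃ η : ℕ → ℝ, IsStepSize M η ∧
            ∀ (Ξ : Type*) [MeasurableSpace Ξ] (law : Measure Ξ) [IsProbabilityMeasure law]
              (g : PolicySpace S A → Ξ → PolicySpace S A) (_ : IsGradientOracle M μ σ law g)
              (Ω : Type*) [MeasurableSpace Ω] (P : Measure Ω) [IsProbabilityMeasure P]
              (ξ : ℕ → Ω → Ξ) (π : ℕ → Ω → PolicySpace S A) (_ : IsPSPG η π₀ law g P ξ π)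
              (πplus : ℕ → Ω → PolicySpace S A)
              (_ : ∀ t ω, IsMirrorStep (policies S A) (value M μ) (LF M) (π t ω) (πplus t ω))
              (T : ℕ)
              (_ : C * globalRate M κ σ ε * (1 + Real.log (1 + globalRate M κ σ ε)) ≤ T),
              ∃ t ≤ T,
                Integrable (fun ω => value M M.p (πplus t ω) - valueStar M M.p) P ∧
                ∫ ω, (value M M.p (πplus t ω) - valueStar M M.p) ∂P ≤ ε) := by
  refine ⟨419904, by norm_num, ?_⟩
  intro S A _ _ M μ hμ π₀ h0 σ hσ ε hε
  have hγ := one_sub_gamma_pos M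
  have hS : Nonempty S := nonempty_state_of_mem_stdSimplex hμ
  have hA : Nonempty A := nonempty_action_of_mem_policies h0 (Classical.arbitrary S)
  refine ⟨?_, ?_⟩
  · rcases (LF_nonneg M).eq_or_lt with hL | hL
    -- If `L_F = 0`, the prefactor `-2ρ` of the envelope `bfbe` vanishes.
    · refine ⟨fun _ => 1 / 1, isStepSize_const one_pos (by rw [← hL]; norm_num), ?_⟩
      intro Ξ _ law _ g ho Ω _ P _ ξ π h T hT _
      have e : ∀ x, bfbe (policies S A) (value M μ) (3 * LF M) x = 0 := fun x => by
        rw [bfbe, ← hL]; simp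
      refine ⟨0, hT, ?_, ?_⟩
      · simp only [e]
        exact integrable_zero _ _ _
      · simp only [e, integral_zero]
        positivity
    · refine ⟨fun _ => 1 / (2 * LF M + 12 * LF M * σ ^ 2 / ε ^ 2),
        isStepSize_const (by positivity) (le_add_of_nonneg_right (by positivity)), ?_⟩
      intro Ξ _ law _ g ho Ω _ P _ ξ π h T hT hTC
      obtain ⟨t, ht, hle⟩ := h.exists_integral_bfbe_le hμ h0 hε hL ho hT (by
        have h1 := mul_le_mul_of_nonneg_left (bfbe_rate_le M (σ := σ) hε)
          (sub_nonneg.2 (valueStar_le M hμ h0))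
        linarith)
      exact ⟨t, ht, integrable_comp_of_continuousOn isCompact_policies
        ((isSmoothOver_value M hμ ⟨π₀, h0⟩).continuousOn_bfbe _)
        (h.measurable_and_indepFun h0 ho.measurable t).1 (h.mem_policies h0 t), hle⟩
  · intro πopt hopt hoptp hoptμ κ hκp hκμ
    have hκ1 : 1 ≤ κ := one_le_of_visitation_le M hμ hμ hopt hκμ
    rcases (LF_nonneg M).eq_or_lt with hL | hL
    -- If `L_F = 0`, the gap bound at a mirror step is zero, so `πplus 0` is already optimal for
    -- `V_p`, whichever minimizer it is.
    · refine ⟨fun _ => 1 / 1, isStepSize_const one_pos (by rw [← hL]; norm_num), ?_⟩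
      intro Ξ _ law _ g ho Ω _ P _ ξ π h πplus hplus T _
      have e : ∀ ω, value M M.p (πplus 0 ω) - valueStar M M.p = 0 := fun ω => by
        have h1 := value_sub_le_of_isMirrorStep M M.p_mem.1 hμ hopt (zero_le_one.trans hκ1) hκp
          (h.mem_policies h0 0 ω) (hplus 0 ω)
        rw [← hL, zero_mul, mul_zero] at h1
        rw [valueStar_eq M hopt hoptp]
        exact le_antisymm h1 (sub_nonneg.2 (hoptp (hplus 0 ω).1))
      refine ⟨0, Nat.zero_le _, ?_, ?_⟩
      · simp only [e]
        exact integrable_zero _ _ _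
      · simp only [e, integral_zero]
        exact hε.le
    · obtain ⟨K, hK⟩ : ∃ K, K = 3 * (κ / (1 - M.γ)) * √(2 * Fintype.card S) := ⟨_, rfl⟩
      refine ⟨fun _ => 1 / (2 * LF M + 18 * K ^ 2 * LF M * σ ^ 2 / ε ^ 2),
        isStepSize_const (by positivity) (le_add_of_nonneg_right (by positivity)), ?_⟩
      intro Ξ _ law _ g ho Ω _ P _ ξ π h πplus hplus T hTC
      have hB := globalRate_pos M (σ := σ) hε (zero_lt_one.trans_le hκ1)
      -- The logarithmic factor is at least one.
      have hTB : 419904 * globalRate M κ σ ε ≤ T := by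
        refine le_trans ?_ hTC
        exact le_mul_of_one_le_right (by positivity)
          (le_add_of_nonneg_right (Real.log_nonneg (by linarith)))
      have hT : 1 ≤ T := by
        have : (0 : ℝ) < T := lt_of_lt_of_le (by positivity) hTB
        exact_mod_cast this
      exact h.exists_integral_value_sub_le hμ h0 hε hL hopt hoptp hoptμ hκp hκμ hK ho hplus hT
        ((value_rate_le M hε hK).trans hTB)
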